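/- Let $f=(f(\mathbf x))_{\mathbf x\in\mathbb R^2}$ be a real, zero-mean, square integrable random field on a probability space which is mean-square continuous and wide-sense stationary, i.e. $r_{ff}(\mathbf x,\boldsymbol\xi)=E[f(\mathbf x)f(\mathbf x-\boldsymbol\xi)]$ does not depend on $\mathbf x$. Assume that $f$ has no random constant component (no spectral mass at wavenumber $\mathbf 0$): the averages of $f$ over the discs $\{\|\mathbf y\|<R\}$ tend to $0$ in mean square as $R\to\infty$. For $l=1,2$ let $$\mathcal R^{(l)}f(\mathbf x)=\frac1{2\pi}\lim_{\varepsilon\to0^+,\,R\to\infty}\iint_{\varepsilon<\|\mathbf x-\mathbf y\|<R}f(\mathbf y)\,\frac{y_l-x_l}{\|\mathbf x-\mathbf y\|^3}\,d\mathbf y\qquad\text{(limit in mean square)}$$ be the Riesz transforms of $f$, and let $m=f+i\,\mathcal R^{(1)}f+j\,\mathcal R^{(2)}f$ be its quaternion-valued monogenic signal. For a pure unit quaternion $\mu$ write $q^{(\mu)}=-\mu q\mu$. Call $m$ $\mathbb C^\eta$-proper if for all pure unit quaternions $\eta',\eta''$ such that $\eta,\eta',\eta''$ are mutually orthogonal one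 has $E[m(\mathbf x)\,(m^{(\eta')}(\mathbf y))^*]=0$ and $E[m(\mathbf x)\,(m^{(\eta'')}(\mathbf y))^*]=0$ for all $\mathbf x,\mathbf y$ (equivalently, this holds for one such pair, for instance $\eta'=-\sin(\nu)i+\cos(\nu)j$ and $\eta''=k$ when $\eta=\cos(\nu)i+\sin(\nu)j$). Then the limits defining $\mathcal R^{(1)}f$ and $\mathcal R^{(2)}f$ exist at every point, and for every $\nu\in\mathbb R$ the monogenic signal $m$ is $\mathbb C^\eta$-proper with $\eta=\cos(\nu)i+\sin(\nu)j$ if and only if $f$ is stationary and unidirectional in direction $\mathbf n=(\cos\nu,\sin\nu)^T$, i.e. there is a function $C:\mathbb R\to\mathbb R$ with $E[f(\mathbf x)f(\mathbf x-\boldsymbol\xi)]=C(\mathbf n^T\boldsymbol\xi)$ for all $\mathbf x,\boldsymbol\xi\in\mathbb R^2$. -/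

import Mathlib

open MeasureTheory Filter Topology

noncomputable section

/-- The plane `ℝ²` with its Euclidean norm. -/
abbrev Plane : Type := EuclideanSpace ℝ (Fin 2)

/-- A real second-order random field on the plane: a square integrable random variable `f x`
at every point `x`. -/
abbrev RandomField {Ω : Type*} [MeasurableSpace Ω] (P : Measure Ω) : Type _ :=
  Plane → Lp ℝ 2 P

/-- The quaternion `a + b i + c j + d k`. -/
def quat (a b c d : ℝ) : Quaternion ℝ := ⟨a, b, c, d⟩

section Field

variable {Ω : Type*} [MeasurableSpace Ω] {P : Measure Ω}

/-- The field has mean zero at every point. -/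
def IsZeroMean (f : RandomField P) : Prop :=
  ∀ x, ∫ ω, f x ω ∂P = 0

/-- The covariance `r_ff(x, ξ) = E[f(x) f(x - ξ)]` of a zero-mean field. -/
def fieldCov (f : RandomField P) (x ξ : Plane) : ℝ :=
  ∫ ω, f x ω * f (x - ξ) ω ∂P

/-- Wide-sense stationarity: `r_ff(x, ξ)` does not depend on the position `x`. -/
def IsStationaryField (f : RandomField P) : Prop :=
  ∀ x x' ξ : Plane, fieldCov f x ξ = fieldCov f x' ξ

/-- The unit vector `n = (cos ν, sin ν)`. -/
def direction (ν : ℝ) : Plane := !₂[Real.cos ν, Real.sin ν]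

/-- The covariance has the form `r_ff(x, ξ) = C(nᵀ ξ)` with `n = (cos ν, sin ν)`. -/
def IsUnidirectionalField (f : RandomField P) (ν : ℝ) : Prop :=
  ∃ C : ℝ → ℝ, ∀ x ξ : Plane, fieldCov f x ξ = C (inner ℝ (direction ν) ξ)

/-- No random constant component (no spectral mass at the zero wavenumber): the averages of the
field over the discs of radius `R` about the origin tend to zero in mean square as `R → ∞`. -/
def HasNoConstantComponent (f : RandomField P) : Prop :=
  Tendsto (fun R : ℝ => ⨍ y in Metric.ball (0 : Plane) R, f y) atTop (𝓝 0)

/-- The truncated Riesz integral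
`(1 / 2π) ∬_{ε < ‖x - y‖ < R} f(y) (y_l - x_l) / ‖x - y‖³ dy`, a Bochner integral in `L²(P)`. -/
def truncatedRiesz (l : Fin 2) (f : RandomField P) (x : Plane) (ε R : ℝ) : Lp ℝ 2 P :=
  (1 / (2 * Real.pi)) •
    ∫ y in {y : Plane | ε < ‖x - y‖ ∧ ‖x - y‖ < R}, ((y l - x l) / ‖x - y‖ ^ 3) • f y

/-- `g` is the `l`-th Riesz transform of `f`: at every point, the principal value integral
converges to `g x` in mean square as `ε → 0+` and `R → ∞`. -/
def IsRieszTransform (l : Fin 2) (f g : RandomField P) : Prop :=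
  ∀ x, Tendsto (fun p : ℝ × ℝ => truncatedRiesz l f x p.1 p.2) (𝓝[>] 0 ×ˢ atTop) (𝓝 (g x))

/-- `m = f + i g + j h` (almost surely, at every point), where `g` and `h` are the first and the
second Riesz transform of `f`. -/
def IsMonogenicSignal (f : RandomField P) (m : Plane → Ω → Quaternion ℝ) : Prop :=
  ∃ g h : RandomField P, IsRieszTransform 0 f g ∧ IsRieszTransform 1 f h ∧
    ∀ x, ∀ᵐ ω ∂P, m x ω = quat (f x ω) (g x ω) (h x ω) 0

end Field

/-- A pure unit quaternion. -/
def IsPureUnit (η : Quaternion ℝ) : Prop := η.re = 0 ∧ ‖η‖ = 1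

/-- The involution `q^(η) = -η q η`. -/
def involution (η q : Quaternion ℝ) : Quaternion ℝ := -(η * q * η)

/-- The complementary covariance matrix `cov{q, q^(η)} = E[q (q^(η))ᴴ]` of a zero-mean quaternion
random vector `q`. -/
def complementaryCov {Ω : Type*} [MeasurableSpace Ω] (P : Measure Ω) {ι : Type*}
    (q : ι → Ω → Quaternion ℝ) (η : Quaternion ℝ) : Matrix ι ι (Quaternion ℝ) :=
  Matrix.of fun a b => ∫ ω, q a ω * star (involution η (q b ω)) ∂P

/-- `ℂ^η`-propriety of a zero-mean quaternion random vector: if `η, η', η''` are orthogonal pure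
unit quaternions, then the complementary covariance matrices for `η'` and `η''` vanish. (If both
vanish for one such choice of `η', η''`, they vanish for every choice.) -/
def IsProperVector {Ω : Type*} [MeasurableSpace Ω] (P : Measure Ω) {ι : Type*}
    (η : Quaternion ℝ) (q : ι → Ω → Quaternion ℝ) : Prop :=
  ∀ η' η'' : Quaternion ℝ, IsPureUnit η' → IsPureUnit η'' →
    inner ℝ η η' = 0 → inner ℝ η η'' = 0 → inner ℝ η' η'' = 0 →
    complementaryCov P q η' = 0 ∧ complementaryCov P q η'' = 0

/-- `ℂ^η`-propriety of a quaternion random field: every finite sample of it is a `ℂ^η`-proper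
random vector. -/
def IsProperField {Ω : Type*} [MeasurableSpace Ω] (P : Measure Ω)
    (η : Quaternion ℝ) (m : Plane → Ω → Quaternion ℝ) : Prop :=
  ∀ (N : ℕ) (x : Fin N → Plane), IsProperVector P η (fun a => m (x a))

/-- The pure unit quaternion `η = cos(ν) i + sin(ν) j`. -/
def etaOf (ν : ℝ) : Quaternion ℝ := quat 0 (Real.cos ν) (Real.sin ν) 0

end

/-! Everything is read off the spectral measure. By Bochner's theorem
(`exists_charFun_eq_of_stationary`) the covariance of `f` is the characteristic function of a finite
measure `F` on the plane. Covariances of moving averages of `f` are integrals against `F` of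
`e^{i⟨k, x - y⟩}` times products of the kernel symbols (`inner_movingAverage_movingAverage`). The
truncated Riesz kernels have uniformly bounded symbols converging to `i k_l / ‖k‖`
(`tendsto_kernelTransform_rieszKernel`), so by dominated convergence the truncations are Cauchy in
`L²`, and the covariances of their limits `g₀`, `g₁` have the expected spectral form.

Two identities follow. The symbols are purely imaginary, so `f` and its Riesz transforms have
antisymmetric cross-covariance. The squares of the `k_l / ‖k‖` sum to one off the origin, and `F {0}
= 0` because `f` has no constant component, so the covariances of `g₀` and `g₁` add up to that of
`f`.

Let `T = -sin ν g₀ + cos ν g₁`. For `η' = -sin(ν) i + cos(ν) j` the real part of the complementary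
variance is `‖f‖² - ‖g₀‖² - ‖g₁‖² + 2‖T‖² = 2‖T‖²`, so propriety forces `T = 0`. Since `‖T‖²` is the
integral of the squared symbol of `T`, this means that `F` lives on the line spanned by `n`.
Conversely, if `T = 0` then `m = f + G η` with `G = cos ν g₀ + sin ν g₁`; on `ℂ^η` the map `q ↦
(q^(η'))*` is the identity, so the complementary covariance is `E[m(x) m(y)]`, which vanishes by the
two identities. Finally, `F` lives on that line exactly when the covariance depends on `nᵀ ξ` alone
(`IsSpectralMeasure.isUnidirectionalField_iff`). -/

noncomputable section

/-! ### Positivity of Gaussian-weighted cosine transforms of a covariance -/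

section Bochner

open Real Complex Module
open scoped FourierTransform RealInnerProductSpace

theorem norm_eq_norm_zero_of_stationary {V H : Type*} [AddGroup V] [NormedAddCommGroup H]
    [InnerProductSpace ℝ H] {f : V → H} {C : V → ℝ} (hC : ∀ x y, ⟪f x, f y⟫ = C (x - y)) (x : V) :
    ‖f x‖ = ‖f 0‖ := by
  have h1 := hC x x
  have h2 := hC 0 0
  rw [sub_self, real_inner_self_eq_norm_sq] at h1 h2
  rw [← sq_eq_sq₀ (norm_nonneg _) (norm_nonneg _), h1, h2]

variable {V : Type*} [NormedAddCommGroup V] [InnerProductSpace ℝ V] [FiniteDimensional ℝ V]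
  [MeasurableSpace V] [BorelSpace V]
  {H : Type*} [NormedAddCommGroup H] [InnerProductSpace ℝ H]

theorem integrable_smul_stationary {f : V → H} (hf : Continuous f) {C : V → ℝ}
    (hC : ∀ x y, ⟪f x, f y⟫ = C (x - y)) {K : V → ℝ} (hK : Integrable K) (x : V) :
    Integrable (fun y => K y • f (x + y)) := by
  refine Integrable.smul_bdd (C := ‖f 0‖) hK ?_ ?_
  · exact (hf.comp (continuous_const.add continuous_id)).aestronglyMeasurable
  · exact .of_forall fun y => (norm_eq_norm_zero_of_stationary hC _).le

theorem integrable_rexp_neg_mul_sq_norm {b : ℝ} (hb : 0 < b) :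
    Integrable (fun x : V => rexp (-b * ‖x‖ ^ 2)) := by
  have := GaussianFourier.integrable_cexp_neg_mul_sq_norm_add (V := V) (b := (b : ℂ))
    (by simpa using hb) 0 0
  refine this.re.congr (.of_forall fun x => ?_)
  simp only [zero_mul, add_zero]
  rw [← Complex.ofReal_neg, ← Complex.ofReal_pow, ← Complex.ofReal_mul, ← Complex.ofReal_exp]
  rfl

/-- The integral of a continuous stationary kernel against a Gaussian weight and a cosine is
nonnegative. -/
theorem integral_cos_mul_gaussian_nonneg [CompleteSpace H] {f : V → H} (hf : Continuous f) {C : V → ℝ}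
    (hC : ∀ x y, ⟪f x, f y⟫ = C (x - y)) {a : ℝ} (ha : 0 < a) (w : V) :
    0 ≤ ∫ u, Real.cos ⟪u, w⟫ * (C u * rexp (-a * ‖u‖ ^ 2)) := by
  -- The rate `2 * a` is chosen so that `g (u + x) * g x` splits into `e^{-a‖u‖²}` times a Gaussian
  -- centred at `-u / 2`, whose integral over `x` does not depend on `u`.
  set g : V → ℝ := fun x => rexp (-(2 * a) * ‖x‖ ^ 2) with hg
  have hgi : Integrable g := integrable_rexp_neg_mul_sq_norm (by positivity)
  have hgc : Continuous g := by fun_prop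
  have hCc : Continuous C := by
    have : C = fun x => ⟪f x, f 0⟫ := by ext x; rw [hC, sub_zero]
    rw [this]; fun_prop
  have hCb : ∀ x, |C x| ≤ ‖f 0‖ ^ 2 := fun x => by
    have := abs_real_inner_le_norm (f x) (f 0)
    rw [hC, sub_zero, norm_eq_norm_zero_of_stationary hC x] at this
    rwa [sq]
  have hcos : Integrable (fun x => Real.cos ⟪x, w⟫ * g x) :=
    hgi.bdd_mul (c := 1) (by fun_prop) (.of_forall fun x => Real.abs_cos_le_one _)
  have hsin : Integrable (fun x => Real.sin ⟪x, w⟫ * g x) :=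
    hgi.bdd_mul (c := 1) (by fun_prop) (.of_forall fun x => Real.abs_sin_le_one _)
  have key : ∀ p : V → ℝ, Integrable p → ‖∫ x, p x • f x‖ ^ 2
      = ∫ y, ∫ x, p y * p x * C (y - x) := by
    intro p hp
    have hpi : Integrable (fun x => p x • f x) := by
      simpa using integrable_smul_stationary hf hC hp 0
    rw [← real_inner_self_eq_norm_sq, ← integral_inner hpi]
    congr 1 with y
    rw [real_inner_smul_right, real_inner_comm, ← integral_inner hpi, ← integral_const_mul]
    congr 1 with x
    rw [real_inner_smul_right, hC]; ring
  have hint : Integrable (fun z : V × V => Real.cos ⟪z.1 - z.2, w⟫ * (g z.1 * g z.2 * C (z.1 - z.2)))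
      (volume.prod volume) := by
    have h1 : Integrable (fun z : V × V => g z.1 * g z.2) (volume.prod volume) := hgi.mul_prod hgi
    have h2 : Integrable (fun z : V × V => (g z.1 * g z.2) * (Real.cos ⟪z.1 - z.2, w⟫ * C (z.1 - z.2)))
        (volume.prod volume) := by
      refine h1.mul_bdd (c := 1 * ‖f 0‖ ^ 2) ?_ ?_
      · exact Continuous.aestronglyMeasurable (by fun_prop)
      · refine .of_forall fun z => ?_
        rw [norm_mul]
        exact mul_le_mul (Real.abs_cos_le_one _) (hCb _) (norm_nonneg _) zero_le_one
    refine h2.congr (.of_forall fun z => ?_)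
    simp only; ring
  -- A real form of `‖∫ e^{i⟨x, w⟩} g(x) f(x) dx‖²`: the addition formula for the cosine merges the
  -- two squares into one double integral.
  have sum_eq : ‖∫ x, (Real.cos ⟪x, w⟫ * g x) • f x‖ ^ 2 + ‖∫ x, (Real.sin ⟪x, w⟫ * g x) • f x‖ ^ 2
      = ∫ y, ∫ x, Real.cos ⟪y - x, w⟫ * (g y * g x * C (y - x)) := by
    have prodint : ∀ p : V → ℝ, Continuous p → Integrable p →
        Integrable (fun z : V × V => p z.1 * p z.2 * C (z.1 - z.2)) (volume.prod volume) := by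
      intro p hpc hp
      exact (hp.mul_prod hp).mul_bdd (c := ‖f 0‖ ^ 2)
        (Continuous.aestronglyMeasurable (by fun_prop)) (.of_forall fun z => hCb _)
    have i1 := prodint _ (by fun_prop) hcos
    have i2 := prodint _ (by fun_prop) hsin
    rw [key _ hcos, key _ hsin, integral_integral i1, integral_integral i2,
      integral_integral hint, ← integral_add i1 i2]
    congr 1 with z
    rw [inner_sub_left, Real.cos_sub]; ring
  have hG : 0 < ∫ y : V, rexp (-(4 * a) * ‖y‖ ^ 2) := by
    rw [GaussianFourier.integral_rexp_neg_mul_sq_norm (by positivity)]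
    positivity
  -- Substituting `y = u + x` separates the double integral into a positive constant times the
  -- integral in question.
  have cv : ∫ y, ∫ x, Real.cos ⟪y - x, w⟫ * (g y * g x * C (y - x))
      = (∫ y : V, rexp (-(4 * a) * ‖y‖ ^ 2)) * ∫ u, Real.cos ⟪u, w⟫ * (C u * rexp (-a * ‖u‖ ^ 2)) := by
    have e1 : ∫ y, ∫ x, Real.cos ⟪y - x, w⟫ * (g y * g x * C (y - x))
        = ∫ x, ∫ u, Real.cos ⟪u, w⟫ * (g (u + x) * g x * C u) := by
      rw [integral_integral_swap hint]
      congr 1 with x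
      rw [← integral_add_right_eq_self _ x]
      simp
    have hint2 : Integrable (fun z : V × V => Real.cos ⟪z.2, w⟫ * (g (z.2 + z.1) * g z.1 * C z.2))
      (volume.prod volume) := by
      refine ((measurePreserving_prod_add (volume : Measure V) (volume : Measure V)).integrable_comp_of_integrable
        hint.swap).congr (.of_forall fun z => ?_)
      simp [add_comm]
    rw [e1, integral_integral_swap hint2, ← integral_const_mul]
    congr 1 with u
    have : ∀ x, Real.cos ⟪u, w⟫ * (g (u + x) * g x * C u)
      = (Real.cos ⟪u, w⟫ * (C u * rexp (-a * ‖u‖ ^ 2))) * rexp (-(4 * a) * ‖x + (1 / 2 : ℝ) • u‖ ^ 2) := by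
      intro x
      have : g (u + x) * g x = rexp (-a * ‖u‖ ^ 2) * rexp (-(4 * a) * ‖x + (1 / 2 : ℝ) • u‖ ^ 2) := by
        simp only [hg]
        rw [← Real.exp_add, ← Real.exp_add, norm_add_sq_real, norm_add_sq_real, norm_smul,
          real_inner_smul_right, real_inner_comm u x]
        congr 1
        simp only [norm_div, norm_one, RCLike.norm_ofNat]
        ring
      rw [this]; ring
    simp_rw [this]
    rw [integral_const_mul, integral_add_right_eq_self (fun x : V => rexp (-(4 * a) * ‖x‖ ^ 2))]
    ring
  have : 0 ≤ (∫ y : V, rexp (-(4 * a) * ‖y‖ ^ 2)) * ∫ u, Real.cos ⟪u, w⟫ * (C u * rexp (-a * ‖u‖ ^ 2)) := by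
    rw [← cv, ← sum_eq]; positivity
  exact nonneg_of_mul_nonneg_right this hG
end Bochner
end

/-! ### Bochner's theorem -/

noncomputable section

section Bochner

open Real Complex Module
open scoped FourierTransform RealInnerProductSpace

variable {V : Type*} [NormedAddCommGroup V] [InnerProductSpace ℝ V] [FiniteDimensional ℝ V]
  [MeasurableSpace V] [BorelSpace V]
  {H : Type*} [NormedAddCommGroup H] [InnerProductSpace ℝ H] [CompleteSpace H]

/-- A bounded integrable function with nonnegative Fourier transform has an integrable Fourier
transform. -/
theorem integrable_fourier_of_nonneg {φ : V → ℂ} (hφ : Integrable φ) {M : ℝ}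
    (hM : ∀ u, ‖φ u‖ ≤ M) {p : V → ℝ} (hp : ∀ w, 𝓕 φ w = p w) (hp0 : ∀ w, 0 ≤ p w) :
    Integrable p := by
  have hcont : Continuous (𝓕 φ) :=
    VectorFourier.fourierIntegral_continuous Real.continuous_fourierChar
      (by exact continuous_inner) hφ
  have hpc : Continuous p := by
    have : p = fun w => (𝓕 φ w).re := by ext w; rw [hp]; simp
    rw [this]; fun_prop
  -- Against a Gaussian weight the transform can be moved from `φ` to the Gaussian. The result has
  -- norm of total mass one, so the bound `M` does not depend on `b`.
  have hbound : ∀ b : ℝ, 0 < b → ∫ w, p w * rexp (-b * ‖w‖ ^ 2) ≤ M := by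
    intro b hb
    have hg : Integrable (fun w : V => cexp (-(b : ℂ) * ‖w‖ ^ 2)) := by
      simpa using GaussianFourier.integrable_cexp_neg_mul_sq_norm_add (V := V) (b := (b : ℂ))
        (by simpa using hb) 0 0
    have h1 : ((∫ w, p w * rexp (-b * ‖w‖ ^ 2) : ℝ) : ℂ)
        = ∫ u, φ u * 𝓕 (fun w : V => cexp (-(b : ℂ) * ‖w‖ ^ 2)) u := by
      have := VectorFourier.integral_fourierIntegral_smul_eq_flip (L := innerₗ V)
        (μ := volume) (ν := volume) Real.continuous_fourierChar continuous_inner hφ hg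
      rw [← integral_complex_ofReal]
      simp only [smul_eq_mul, flip_innerₗ] at this
      refine Eq.trans ?_ this
      congr 1 with w
      have h2 := hp w
      push_cast
      rw [← h2]; rfl
    have h2 : ‖∫ u, φ u * 𝓕 (fun w : V => cexp (-(b : ℂ) * ‖w‖ ^ 2)) u‖ ≤ M := by
      have hn : ∀ u : V, ‖𝓕 (fun w : V => cexp (-(b : ℂ) * ‖w‖ ^ 2)) u‖
          = (π / b) ^ (finrank ℝ V / 2 : ℝ) * rexp (-(π ^ 2 / b) * ‖u‖ ^ 2) := by
        intro u
        rw [fourier_gaussian_innerProductSpace (by simpa using hb), norm_mul, Complex.norm_exp]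
        congr 1
        · rw [← Complex.ofReal_div, ← Complex.ofReal_natCast, ← Complex.ofReal_ofNat,
            ← Complex.ofReal_div, ← Complex.ofReal_cpow (by positivity), Complex.norm_real,
            Real.norm_of_nonneg (by positivity)]
        · congr 1
          rw [← Complex.ofReal_pow, ← Complex.ofReal_pow, ← Complex.ofReal_neg,
            ← Complex.ofReal_mul, ← Complex.ofReal_div, Complex.ofReal_re]
          ring
      have hgi : Integrable (fun u : V => rexp (-(π ^ 2 / b) * ‖u‖ ^ 2)) :=
        integrable_rexp_neg_mul_sq_norm (by positivity)
      calc _ ≤ ∫ u : V, M * ((π / b) ^ (finrank ℝ V / 2 : ℝ) * rexp (-(π ^ 2 / b) * ‖u‖ ^ 2)) := by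
            refine norm_integral_le_of_norm_le ((hgi.const_mul _).const_mul _)
              (.of_forall fun u => ?_)
            rw [norm_mul, hn]
            exact mul_le_mul_of_nonneg_right (hM u) (by positivity)
        _ = M := by
            rw [integral_const_mul, integral_const_mul,
              GaussianFourier.integral_rexp_neg_mul_sq_norm (by positivity),
              ← Real.mul_rpow (by positivity) (by positivity)]
            have : π / b * (π / (π ^ 2 / b)) = 1 := by field_simp
            rw [this, Real.one_rpow, mul_one]
    rw [← h1, Complex.norm_real] at h2
    exact (le_abs_self _).trans h2
  refine AECover.integrable_of_integral_bounded_of_nonneg_ae (l := atTop)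
    (φ := fun n : ℕ => Metric.ball (0 : V) ((n : ℝ) + 1)) (aecover_ball
    (tendsto_natCast_atTop_atTop.atTop_add tendsto_const_nhds)) (rexp 1 * M) (fun n => ?_)
    (.of_forall hp0) (.of_forall fun n => ?_)
  · exact (hpc.continuousOn.integrableOn_compact (isCompact_closedBall 0 _)).mono_set
      Metric.ball_subset_closedBall
  · set r : ℝ := (n : ℝ) + 1 with hr
    have hr0 : 0 < r := by positivity
    -- With `b = r⁻²` the weight is at least `1 / e` on the ball of radius `r`; this bounds the
    -- integral over every ball by `e * M`.
    have hb : 0 < (r ^ 2)⁻¹ := by positivity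
    have hpb : Integrable (fun w => p w * rexp (-(r ^ 2)⁻¹ * ‖w‖ ^ 2)) := by
      have hgi : Integrable (fun u : V => rexp (-(r ^ 2)⁻¹ * ‖u‖ ^ 2)) :=
        integrable_rexp_neg_mul_sq_norm (by positivity)
      refine hgi.bdd_mul (c := ∫ u, ‖φ u‖) hpc.aestronglyMeasurable (.of_forall fun w => ?_)
      have : ‖p w‖ = ‖𝓕 φ w‖ := by rw [hp, Complex.norm_real]
      rw [this]
      exact VectorFourier.norm_fourierIntegral_le_integral_norm _ _ _ _ _
    calc ∫ w in Metric.ball (0 : V) r, p w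
        ≤ ∫ w in Metric.ball (0 : V) r, rexp 1 * (p w * rexp (-(r ^ 2)⁻¹ * ‖w‖ ^ 2)) := by
          refine setIntegral_mono_on ?_ (hpb.const_mul _).integrableOn Metric.isOpen_ball.measurableSet ?_
          · exact (hpc.continuousOn.integrableOn_compact (isCompact_closedBall 0 _)).mono_set
              Metric.ball_subset_closedBall
          · intro w hw
            rw [mem_ball_zero_iff] at hw
            have : 1 ≤ rexp 1 * rexp (-(r ^ 2)⁻¹ * ‖w‖ ^ 2) := by
              rw [← Real.exp_add, Real.one_le_exp_iff]
              have : (r ^ 2)⁻¹ * ‖w‖ ^ 2 ≤ 1 := by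
                rw [inv_mul_le_iff₀ (by positivity), mul_one]
                exact pow_le_pow_left₀ (norm_nonneg _) hw.le 2
              linarith
            nlinarith [hp0 w]
      _ ≤ ∫ w, rexp 1 * (p w * rexp (-(r ^ 2)⁻¹ * ‖w‖ ^ 2)) := by
          refine setIntegral_le_integral (hpb.const_mul _) (.of_forall fun w => ?_)
          have := hp0 w
          positivity
      _ ≤ rexp 1 * M := by
          rw [integral_const_mul]
          exact mul_le_mul_of_nonneg_left (hbound _ hb) (by positivity)

/-- A continuous integrable bounded function with nonnegative Fourier transform is a
characteristic function. -/
theorem exists_charFun_eq_of_fourier_nonneg {φ : V → ℂ} (hφ : Integrable φ) (hc : Continuous φ)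
    {M : ℝ} (hM : ∀ u, ‖φ u‖ ≤ M) {p : V → ℝ} (hp : ∀ w, 𝓕 φ w = p w) (hp0 : ∀ w, 0 ≤ p w) :
    ∃ μ : Measure V, IsFiniteMeasure μ ∧ ∀ ξ, charFun μ ξ = φ ξ := by
  have hpi := integrable_fourier_of_nonneg hφ hM hp hp0
  have hF : 𝓕 φ = fun w => (p w : ℂ) := funext hp
  have inv := hc.fourierInv_fourier_eq hφ (by rw [hF]; exact hpi.ofReal)
  set ν : Measure V := volume.withDensity fun w => ENNReal.ofReal (p w) with hν
  have hνf : IsFiniteMeasure ν := isFiniteMeasure_withDensity_ofReal hpi.2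
  -- The dilation by `2 * π` passes from the `e^{2πi⟨w, ξ⟩}` of Fourier inversion to the `e^{i⟨w,
  -- ξ⟩}` of `charFun`.
  refine ⟨ν.map (fun w => (2 * π) • w), inferInstance, fun ξ => ?_⟩
  rw [charFun_map_smul, charFun_apply, ← inv, fourierInv_eq', hF, hν]
  rw [integral_withDensity_eq_integral_toReal_smul₀ hpi.1.aemeasurable.ennreal_ofReal
    (.of_forall fun _ => ENNReal.ofReal_lt_top)]
  congr 1 with w
  rw [ENNReal.toReal_ofReal (hp0 w), real_inner_smul_right, smul_eq_mul, Complex.real_smul, mul_comm]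

/-- The covariance of a stationary process, tempered by a Gaussian, is a characteristic
function. -/
theorem exists_charFun_eq_mul_gaussian {f : V → H} (hf : Continuous f) {C : V → ℝ}
    (hC : ∀ x y, ⟪f x, f y⟫ = C (x - y)) {a : ℝ} (ha : 0 < a) :
    ∃ μ : Measure V, IsFiniteMeasure μ ∧
      ∀ ξ, charFun μ ξ = ((C ξ * rexp (-a * ‖ξ‖ ^ 2) : ℝ) : ℂ) := by
  have hCc : Continuous C := by
    have : C = fun x => ⟪f x, f 0⟫ := by ext x; rw [hC, sub_zero]
    rw [this]; fun_prop
  have hCb : ∀ x, |C x| ≤ ‖f 0‖ ^ 2 := fun x => by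
    have := abs_real_inner_le_norm (f x) (f 0)
    rw [hC, sub_zero, norm_eq_norm_zero_of_stationary hC x] at this
    rwa [sq]
  have hCe : ∀ x, C (-x) = C x := fun x => by
    have h1 := hC x 0
    have h2 := hC 0 x
    rw [sub_zero] at h1
    rw [zero_sub] at h2
    rw [← h1, ← h2, real_inner_comm]
  have hgi : Integrable (fun u : V => rexp (-a * ‖u‖ ^ 2)) :=
        integrable_rexp_neg_mul_sq_norm (by positivity)
  have hi : Integrable (fun u => C u * rexp (-a * ‖u‖ ^ 2)) :=
    hgi.bdd_mul (c := ‖f 0‖ ^ 2) hCc.aestronglyMeasurable (.of_forall hCb)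
  set φ : V → ℂ := fun ξ => ((C ξ * rexp (-a * ‖ξ‖ ^ 2) : ℝ) : ℂ) with hφ
  have hφi : Integrable φ := hi.ofReal
  -- The transform is real because `C` is even.
  have hreal : ∀ w, 𝓕 φ w = ((𝓕 φ w).re : ℂ) := by
    intro w
    refine (Complex.conj_eq_iff_re.1 ?_).symm
    rw [fourier_eq', ← integral_conj, ← integral_neg_eq_self]
    congr 1 with v
    simp only [smul_eq_mul, map_mul, hφ, Complex.conj_ofReal, hCe, norm_neg, inner_neg_left,
      ← Complex.exp_conj, Complex.conj_I]
    congr 2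
    push_cast
    ring
  refine exists_charFun_eq_of_fourier_nonneg hφi (by fun_prop) (M := ‖f 0‖ ^ 2) (fun u => ?_) hreal
    (fun w => ?_)
  · rw [Complex.norm_real, norm_mul]
    refine (mul_le_mul (hCb u) ?_ (norm_nonneg _) (by positivity)).trans_eq (mul_one _)
    rw [Real.norm_of_nonneg (Real.exp_pos _).le, Real.exp_le_one_iff]
    have : 0 ≤ a * ‖u‖ ^ 2 := by positivity
    linarith
  · have := integral_cos_mul_gaussian_nonneg hf hC ha ((2 * π) • w)
    refine this.trans_eq ?_
    rw [fourier_eq']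
    have hint : Integrable (fun v => cexp (((-2 * π * ⟪v, w⟫ : ℝ) : ℂ) * I) • φ v) := by
      refine hφi.bdd_smul (C := 1) (show Continuous fun v =>
        cexp (((-2 * π * ⟪v, w⟫ : ℝ) : ℂ) * I) by fun_prop).aestronglyMeasurable (.of_forall fun v => ?_)
      rw [Complex.norm_exp_ofReal_mul_I]
    refine Eq.trans ?_ (integral_re hint)
    congr 1 with v
    simp only [hφ, smul_eq_mul]
    rw [RCLike.re_eq_complex_re, Complex.re_mul_ofReal, Complex.exp_ofReal_mul_I_re,
      real_inner_smul_right, ← Real.cos_neg]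
    congr 2
    ring

/-- **Bochner's theorem** for the covariance of a continuous stationary process. -/
theorem exists_charFun_eq_of_stationary {f : V → H} (hf : Continuous f) {C : V → ℝ}
    (hC : ∀ x y, ⟪f x, f y⟫ = C (x - y)) :
    ∃ F : Measure V, IsFiniteMeasure F ∧ ∀ ξ, charFun F ξ = (C ξ : ℂ) := by
  have hCc : Continuous C := by
    have : C = fun x => ⟪f x, f 0⟫ := by ext x; rw [hC, sub_zero]
    rw [this]; fun_prop
  have hC0 : C 0 = ‖f 0‖ ^ 2 := by rw [← real_inner_self_eq_norm_sq, hC, sub_zero]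
  -- The normalisation to probability measures divides by `C 0 = ‖f 0‖²`; if that is zero, the whole
  -- process vanishes.
  rcases eq_or_ne (f 0) 0 with h0 | h0
  · refine ⟨0, inferInstance, fun ξ => ?_⟩
    have : f ξ = 0 := by
      rw [← norm_eq_zero, norm_eq_norm_zero_of_stationary hC, h0, norm_zero]
    have h1 := hC ξ 0
    rw [this, inner_zero_left, sub_zero] at h1
    simp [← h1]
  have hpos : 0 < C 0 := by rw [hC0]; positivity
  choose μ hμf hμ using fun n : ℕ =>
    exists_charFun_eq_mul_gaussian hf hC (a := 1 / ((n : ℝ) + 1)) (by positivity)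
  have hmass : ∀ n, μ n Set.univ = ENNReal.ofReal (C 0) := by
    intro n
    have := hμ n 0
    rw [charFun_zero] at this
    have h2 : (μ n).real Set.univ = C 0 := by
      have h3 := Complex.ofReal_injective this
      simpa using h3
    rw [← h2, ofReal_measureReal]
  set ν : ℕ → Measure V := fun n => (ENNReal.ofReal (C 0))⁻¹ • μ n with hν
  have hνp : ∀ n, IsProbabilityMeasure (ν n) := fun n => ⟨by
    rw [hν]
    simp only [Measure.smul_apply, hmass, smul_eq_mul]
    exact ENNReal.inv_mul_cancel (by simpa using hpos) ENNReal.ofReal_ne_top⟩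
  have hνc : ∀ n ξ, charFun (ν n) ξ = (((C 0)⁻¹ * (C ξ * rexp (-(1 / ((n : ℝ) + 1)) * ‖ξ‖ ^ 2)) : ℝ) : ℂ) := by
    intro n ξ
    rw [charFun_apply, hν, integral_smul_measure, ← charFun_apply, hμ, ENNReal.toReal_inv,
      ENNReal.toReal_ofReal hpos.le, Complex.real_smul, ← Complex.ofReal_mul]
  have hlim : ∀ ξ, Tendsto (fun n => charFun (ν n) ξ) atTop (𝓝 (((C 0)⁻¹ * C ξ : ℝ) : ℂ)) := by
    intro ξ
    simp_rw [hνc]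
    refine (Complex.continuous_ofReal.tendsto _).comp ?_
    refine tendsto_const_nhds.mul ?_
    have h1 : Tendsto (fun n : ℕ => rexp (-(1 / ((n : ℝ) + 1)) * ‖ξ‖ ^ 2)) atTop (𝓝 (rexp (-0 * ‖ξ‖ ^ 2))) :=
      (Real.continuous_exp.tendsto _).comp
        ((tendsto_one_div_add_atTop_nhds_zero_nat.neg).mul_const _)
    simpa using h1.const_mul (C ξ)
  -- The characteristic functions converge pointwise to a continuous function, which gives tightness
  -- and, by Prokhorov's theorem, relative compactness.
  have htight : IsTightMeasureSet (Set.range ν) :=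
    isTightMeasureSet_of_tendsto_charFun (f := fun ξ => (((C 0)⁻¹ * C ξ : ℝ) : ℂ))
      (by fun_prop) hlim
  let νp : ℕ → ProbabilityMeasure V := fun n => ⟨ν n, hνp n⟩
  have hcomp : IsCompact (closure (Set.range νp)) := by
    refine isCompact_closure_of_isTightMeasureSet ?_
    convert htight using 1
    ext m
    constructor
    · rintro ⟨_, ⟨n, rfl⟩, rfl⟩
      exact ⟨n, rfl⟩
    · rintro ⟨n, rfl⟩
      exact ⟨νp n, ⟨n, rfl⟩, rfl⟩
  -- A limit along an ultrafilter replaces the extraction of a weakly convergent subsequence.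
  let U : Ultrafilter ℕ := Ultrafilter.of atTop
  have hU : (U : Filter ℕ) ≤ atTop := Ultrafilter.of_le _
  obtain ⟨F, -, hF⟩ := hcomp.ultrafilter_le_nhds (U.map νp)
    (le_trans (by simp) (monotone_principal subset_closure))
  have hFt : Tendsto νp U (𝓝 F) := hF
  have hFc : ∀ ξ, charFun (F : Measure V) ξ = (((C 0)⁻¹ * C ξ : ℝ) : ℂ) := by
    intro ξ
    rw [ProbabilityMeasure.tendsto_iff_forall_integral_rclike_tendsto ℂ] at hFt
    have h1 := hFt (BoundedContinuousFunction.innerProbChar ξ)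
    simp_rw [← charFun_eq_integral_innerProbChar] at h1
    exact tendsto_nhds_unique h1 ((hlim ξ).comp hU)
  refine ⟨ENNReal.ofReal (C 0) • (F : Measure V), ⟨?_⟩, fun ξ => ?_⟩
  · simp only [Measure.smul_apply, smul_eq_mul, measure_univ, mul_one]
    exact ENNReal.ofReal_lt_top
  · rw [charFun_apply, integral_smul_measure, ← charFun_apply, hFc, ENNReal.toReal_ofReal hpos.le,
      Complex.real_smul, ← Complex.ofReal_mul, mul_inv_cancel_left₀ hpos.ne']

end Bochner
end

/-! ### Spectral calculus of moving averages and their mean-square limits -/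

noncomputable section

section SpectralCalculus

open Complex
open scoped RealInnerProductSpace ComplexConjugate

variable {V : Type*} [NormedAddCommGroup V] [InnerProductSpace ℝ V] [MeasurableSpace V]

/-- The integral `∫ e^{i⟨k, z⟩} φ(k) dF(k)`. -/
def spectralIntegral (F : Measure V) (z : V) (φ : V → ℂ) : ℂ :=
  ∫ k, cexp (⟪k, z⟫ * I) * φ k ∂F

theorem conj_spectralIntegral (F : Measure V) (z : V) (φ : V → ℂ) :
    conj (spectralIntegral F z φ) = spectralIntegral F (-z) (fun k => conj (φ k)) := by
  rw [spectralIntegral, spectralIntegral, ← integral_conj]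
  congr 1 with k
  rw [map_mul, ← Complex.exp_conj, map_mul, conj_I, conj_ofReal, inner_neg_right]
  congr 2
  push_cast
  ring

theorem spectralIntegral_one (F : Measure V) (z : V) :
    spectralIntegral F z (fun _ => 1) = charFun F z := by
  simp [spectralIntegral, charFun_apply]

theorem norm_spectralIntegrand_le {V : Type*} [NormedAddCommGroup V] [InnerProductSpace ℝ V] (k z : V) {a B : ℝ} {u : ℂ} (hu : ‖u‖ ≤ B) (h : B ≤ a) :
    ‖cexp (⟪k, z⟫ * I) * u‖ ≤ a := by
  rw [norm_mul, norm_exp_ofReal_mul_I, one_mul]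
  exact hu.trans h

variable [FiniteDimensional ℝ V] [BorelSpace V]

/-- The transform `∫ K(y) e^{i⟨k, y⟩} dy` of a real kernel. -/
def kernelTransform (K : V → ℝ) (k : V) : ℂ := ∫ y, (K y : ℂ) * cexp (⟪k, y⟫ * I)

theorem continuous_kernelTransform {K : V → ℝ} (hK : Integrable K) :
    Continuous (kernelTransform K) := by
  refine continuous_of_dominated (bound := fun y => ‖K y‖) (fun k => ?_) (fun k => ?_) hK.norm ?_
  · exact (hK.ofReal (𝕜 := ℂ)).1.mul
      (show Continuous fun y => cexp (⟪k, y⟫ * I) by fun_prop).aestronglyMeasurable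
  · refine .of_forall fun y => ?_
    rw [norm_mul, norm_exp_ofReal_mul_I, mul_one, norm_real]
  · exact .of_forall fun y => by fun_prop

theorem norm_kernelTransform_le {K : V → ℝ} (k : V) :
    ‖kernelTransform K k‖ ≤ ∫ y, ‖K y‖ := by
  refine (norm_integral_le_integral_norm _).trans_eq ?_
  congr 1 with y
  rw [norm_mul, norm_exp_ofReal_mul_I, mul_one, norm_real]

/-- Fubini: averaging over translations by `y` with weight `K` multiplies the integrand by the
symbol of `K`. All covariance formulas below come from applying this once or twice. -/
theorem integral_kernel_mul_spectralIntegral {F : Measure V} [IsFiniteMeasure F] {K : V → ℝ}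
    (hK : Integrable K) {φ : V → ℂ} (hφ : Integrable φ F) (z : V) :
    ∫ y, (K y : ℂ) * spectralIntegral F (z + y) φ
      = spectralIntegral F z (fun k => kernelTransform K k * φ k) := by
  have hi : Integrable (fun p : V × V => cexp (⟪p.2, z + p.1⟫ * I) * ((K p.1 : ℂ) * φ p.2))
      (volume.prod F) := by
    refine (hK.ofReal.mul_prod hφ).bdd_mul (c := 1)
      (show Continuous fun p : V × V => cexp (⟪p.2, z + p.1⟫ * I) by fun_prop).aestronglyMeasurable
      (.of_forall fun p => ?_)
    rw [norm_exp_ofReal_mul_I]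
  calc ∫ y, (K y : ℂ) * spectralIntegral F (z + y) φ
      = ∫ y, ∫ k, cexp (⟪k, z + y⟫ * I) * ((K y : ℂ) * φ k) ∂F := by
        congr 1 with y
        rw [spectralIntegral, ← integral_const_mul]
        congr 1 with k
        ring
    _ = ∫ k, (∫ y, cexp (⟪k, z + y⟫ * I) * ((K y : ℂ) * φ k)) ∂F := integral_integral_swap hi
    _ = _ := by
        rw [spectralIntegral]
        congr 1 with k
        rw [kernelTransform, ← integral_mul_const, ← integral_const_mul]
        congr 1 with y
        rw [inner_add_right]
        push_cast
        rw [add_mul, Complex.exp_add]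
        ring

variable {H : Type*} [NormedAddCommGroup H] [InnerProductSpace ℝ H] [CompleteSpace H]

/-- The moving average `∫ K(y) f(x + y) dy` of a process. -/
def movingAverage (K : V → ℝ) (f : V → H) (x : V) : H := ∫ y, K y • f (x + y)

theorem inner_movingAverage_left {f : V → H} (hf : Continuous f) {C : V → ℝ}
    (hC : ∀ x y, ⟪f x, f y⟫ = C (x - y)) {F : Measure V} [IsFiniteMeasure F]
    (hF : ∀ ξ, charFun F ξ = (C ξ : ℂ)) {K : V → ℝ} (hK : Integrable K) (x x' : V) :
    ((⟪movingAverage K f x, f x'⟫ : ℝ) : ℂ) = spectralIntegral F (x - x') (kernelTransform K) := by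
  have h := integral_kernel_mul_spectralIntegral (F := F) hK (φ := fun _ => 1)
    (integrable_const _) (x - x')
  simp only [spectralIntegral_one, hF, mul_one] at h
  refine Eq.trans ?_ h
  rw [movingAverage, real_inner_comm, ← integral_inner (integrable_smul_stationary hf hC hK x),
    ← integral_complex_ofReal]
  congr 1 with y
  rw [real_inner_smul_right, real_inner_comm, hC]
  push_cast
  congr 3
  abel

theorem inner_movingAverage_movingAverage {f : V → H} (hf : Continuous f) {C : V → ℝ}
    (hC : ∀ x y, ⟪f x, f y⟫ = C (x - y)) {F : Measure V} [IsFiniteMeasure F]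
    (hF : ∀ ξ, charFun F ξ = (C ξ : ℂ)) {K L : V → ℝ} (hK : Integrable K) (hL : Integrable L)
    (x x' : V) :
    ((⟪movingAverage K f x, movingAverage L f x'⟫ : ℝ) : ℂ)
      = spectralIntegral F (x - x') (fun k => kernelTransform K k * conj (kernelTransform L k)) := by
  have hφ : Integrable (fun k => conj (kernelTransform K k)) F := by
    refine Integrable.of_bound (C := ∫ y, ‖K y‖)
      (Complex.continuous_conj.comp (continuous_kernelTransform hK)).aestronglyMeasurable
      (.of_forall fun k => ?_)
    rw [RCLike.norm_conj]
    exact norm_kernelTransform_le k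
  have h := integral_kernel_mul_spectralIntegral (F := F) hL hφ (x' - x)
  have h2 : ((⟪movingAverage K f x, movingAverage L f x'⟫ : ℝ) : ℂ)
      = ∫ y, (L y : ℂ) * spectralIntegral F (x' - x + y) (fun k => conj (kernelTransform K k)) := by
    rw [movingAverage.eq_1 L, ← integral_inner (integrable_smul_stationary hf hC hL x'),
      ← integral_complex_ofReal]
    congr 1 with y
    rw [real_inner_smul_right]
    push_cast
    -- The inner product is real, so it may be conjugated. This reflects the argument to `x' - x +
    -- y`, the form in which the second kernel can be averaged.
    rw [← conj_ofReal (⟪movingAverage K f x, f (x' + y)⟫), inner_movingAverage_left hf hC hF hK,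
      conj_spectralIntegral]
    congr 2
    abel
  rw [← conj_ofReal, h2, h, conj_spectralIntegral]
  congr 1
  · abel
  · ext k
    rw [map_mul, conj_conj, mul_comm]

variable {ι κ : Type*} {l : Filter ι} {l' : Filter κ} [l.IsCountablyGenerated]
  [l'.IsCountablyGenerated]

/-- Dominated convergence with the constant majorant `A * B`, integrable since `F` is finite. The
two indices run independently, so that the statement yields the Cauchy criterion as well as the
covariances of limits. -/
theorem tendsto_inner_movingAverage {f : V → H} (hf : Continuous f) {C : V → ℝ}
    (hC : ∀ x y, ⟪f x, f y⟫ = C (x - y)) {F : Measure V} [IsFiniteMeasure F]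
    (hF : ∀ ξ, charFun F ξ = (C ξ : ℂ)) {K : ι → V → ℝ} (hK : ∀ i, Integrable (K i))
    {L : κ → V → ℝ} (hL : ∀ i, Integrable (L i)) {A B : ℝ}
    (hKA : ∀ᶠ i in l, ∀ k, ‖kernelTransform (K i) k‖ ≤ A)
    (hLB : ∀ᶠ i in l', ∀ k, ‖kernelTransform (L i) k‖ ≤ B) {m n : V → ℂ}
    (hm : ∀ k, Tendsto (fun i => kernelTransform (K i) k) l (𝓝 (m k)))
    (hn : ∀ k, Tendsto (fun i => kernelTransform (L i) k) l' (𝓝 (n k))) (x x' : V) :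
    Tendsto (fun p : ι × κ =>
        ((⟪movingAverage (K p.1) f x, movingAverage (L p.2) f x'⟫ : ℝ) : ℂ)) (l ×ˢ l')
      (𝓝 (spectralIntegral F (x - x') (fun k => m k * conj (n k)))) := by
  simp_rw [inner_movingAverage_movingAverage hf hC hF (hK _) (hL _)]
  refine tendsto_integral_filter_of_dominated_convergence (fun _ => A * B) ?_ ?_
    (integrable_const _) (.of_forall fun k => ?_)
  · refine .of_forall fun p => Continuous.aestronglyMeasurable ?_
    have h1 := continuous_kernelTransform (hK p.1)
    have h2 := Complex.continuous_conj.comp (continuous_kernelTransform (hL p.2))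
    exact (show Continuous fun k => cexp (⟪k, x - x'⟫ * I) by fun_prop).mul (h1.mul h2)
  · filter_upwards [hKA.prod_mk hLB] with p hp
    refine .of_forall fun k => norm_spectralIntegrand_le _ _ ?_ le_rfl
    rw [norm_mul, RCLike.norm_conj]
    exact mul_le_mul (hp.1 k) (hp.2 k) (norm_nonneg _) ((norm_nonneg _).trans (hp.1 k))
  · exact ((hm k).comp tendsto_fst).mul
      ((Complex.continuous_conj.tendsto _).comp ((hn k).comp tendsto_snd)) |>.const_mul _

/-- Moving averages converge in mean square when the kernel transforms converge boundedly. -/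
theorem exists_tendsto_movingAverage [l.NeBot] {f : V → H} (hf : Continuous f) {C : V → ℝ}
    (hC : ∀ x y, ⟪f x, f y⟫ = C (x - y)) {F : Measure V} [IsFiniteMeasure F]
    (hF : ∀ ξ, charFun F ξ = (C ξ : ℂ)) {K : ι → V → ℝ} (hK : ∀ i, Integrable (K i)) {A : ℝ}
    (hKA : ∀ᶠ i in l, ∀ k, ‖kernelTransform (K i) k‖ ≤ A) {m : V → ℂ}
    (hm : ∀ k, Tendsto (fun i => kernelTransform (K i) k) l (𝓝 (m k))) (x : V) :
    ∃ g, Tendsto (fun i => movingAverage (K i) f x) l (𝓝 g) := by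
  have h1 := (Complex.continuous_re.tendsto _).comp
    (tendsto_inner_movingAverage hf hC hF hK hK hKA hKA hm hm x x)
  simp only [Function.comp_def, ofReal_re] at h1
  have h2 := h1.comp tendsto_diag
  -- Expanding the square gives three inner products with one common limit, entering with
  -- coefficients `1, -2, 1`.
  have h3 : Tendsto (fun p : ι × ι => ‖movingAverage (K p.1) f x - movingAverage (K p.2) f x‖ ^ 2)
      (l ×ˢ l) (𝓝 0) := by
    have := ((h2.comp (tendsto_fst (f := l) (g := l))).sub (h1.const_mul 2)).add
      (h2.comp (tendsto_snd (f := l) (g := l)))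
    refine (this.congr fun p => ?_).trans_eq (by congr 1; ring)
    simp only [Function.comp_def, Function.diag, real_inner_self_eq_norm_sq]
    rw [norm_sub_sq_real]
  have h4 : Cauchy (l.map fun i => movingAverage (K i) f x) := by
    rw [cauchy_map_iff]
    refine ⟨inferInstance, ?_⟩
    rw [Metric.uniformity_eq_comap_nhds_zero, tendsto_comap_iff]
    have := h3.sqrt
    simpa [Function.comp_def, dist_eq_norm, Real.sqrt_sq] using this
  exact CompleteSpace.complete h4

theorem inner_limit_movingAverage_limit_movingAverage [l.NeBot] [l'.NeBot]
    {f : V → H} (hf : Continuous f) {C : V → ℝ}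
    (hC : ∀ x y, ⟪f x, f y⟫ = C (x - y)) {F : Measure V} [IsFiniteMeasure F]
    (hF : ∀ ξ, charFun F ξ = (C ξ : ℂ)) {K : ι → V → ℝ} (hK : ∀ i, Integrable (K i))
    {L : κ → V → ℝ} (hL : ∀ i, Integrable (L i)) {A B : ℝ}
    (hKA : ∀ᶠ i in l, ∀ k, ‖kernelTransform (K i) k‖ ≤ A)
    (hLB : ∀ᶠ i in l', ∀ k, ‖kernelTransform (L i) k‖ ≤ B) {m n : V → ℂ}
    (hm : ∀ k, Tendsto (fun i => kernelTransform (K i) k) l (𝓝 (m k)))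
    (hn : ∀ k, Tendsto (fun i => kernelTransform (L i) k) l' (𝓝 (n k))) {x x' : V} {g h : H}
    (hg : Tendsto (fun i => movingAverage (K i) f x) l (𝓝 g))
    (hh : Tendsto (fun i => movingAverage (L i) f x') l' (𝓝 h)) :
    ((⟪g, h⟫ : ℝ) : ℂ) = spectralIntegral F (x - x') (fun k => m k * conj (n k)) := by
  refine tendsto_nhds_unique ?_ (tendsto_inner_movingAverage hf hC hF hK hL hKA hLB hm hn x x')
  exact (continuous_ofReal.tendsto _).comp ((hg.comp tendsto_fst).inner (hh.comp tendsto_snd))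

theorem inner_limit_movingAverage [l.NeBot]
    {f : V → H} (hf : Continuous f) {C : V → ℝ}
    (hC : ∀ x y, ⟪f x, f y⟫ = C (x - y)) {F : Measure V} [IsFiniteMeasure F]
    (hF : ∀ ξ, charFun F ξ = (C ξ : ℂ)) {K : ι → V → ℝ} (hK : ∀ i, Integrable (K i)) {A : ℝ}
    (hKA : ∀ᶠ i in l, ∀ k, ‖kernelTransform (K i) k‖ ≤ A) {m : V → ℂ}
    (hm : ∀ k, Tendsto (fun i => kernelTransform (K i) k) l (𝓝 (m k))) {x : V} {g : H}
    (hg : Tendsto (fun i => movingAverage (K i) f x) l (𝓝 g)) (x' : V) :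
    ((⟪g, f x'⟫ : ℝ) : ℂ) = spectralIntegral F (x - x') m := by
  have h1 : Tendsto (fun i => ((⟪movingAverage (K i) f x, f x'⟫ : ℝ) : ℂ)) l
      (𝓝 ((⟪g, f x'⟫ : ℝ) : ℂ)) :=
    (continuous_ofReal.tendsto _).comp (hg.inner tendsto_const_nhds)
  refine tendsto_nhds_unique h1 ?_
  simp_rw [inner_movingAverage_left hf hC hF (hK _)]
  refine tendsto_integral_filter_of_dominated_convergence (fun _ => A) ?_ ?_
    (integrable_const _) (.of_forall fun k => (hm k).const_mul _)
  · refine .of_forall fun i => Continuous.aestronglyMeasurable ?_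
    exact (show Continuous fun k => cexp (⟪k, x - x'⟫ * I) by fun_prop).mul
      (continuous_kernelTransform (hK i))
  · filter_upwards [hKA] with i hi
    exact .of_forall fun k => norm_spectralIntegrand_le _ _ (hi k) le_rfl

end SpectralCalculus
end

/-! ### The sine integral and its limit -/

noncomputable section

section DirichletIntegral

open Real

/-- The sine integral `∫₀ᵗ sin x / x dx`. -/
def sineIntegral (t : ℝ) : ℝ := ∫ x in (0 : ℝ)..t, sinc x

theorem continuous_sineIntegral : Continuous sineIntegral :=
  intervalIntegral.continuous_primitive (fun _ _ => continuous_sinc.intervalIntegrable _ _) 0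

theorem sineIntegral_neg (t : ℝ) : sineIntegral (-t) = -sineIntegral t := by
  have := intervalIntegral.integral_comp_neg (a := 0) (b := t) sinc
  simp only [sinc_neg, neg_zero] at this
  rw [sineIntegral, sineIntegral, this, intervalIntegral.integral_symm]

theorem integral_exp_neg_mul_mul_sin (t T : ℝ) :
    ∫ x in (0 : ℝ)..T, rexp (-(x * t)) * sin x
      = (1 + t ^ 2)⁻¹ - rexp (-(T * t)) * (cos T + t * sin T) * (1 + t ^ 2)⁻¹ := by
  have hd : ∀ x ∈ Set.uIcc 0 T, HasDerivAt
      (fun x => -(rexp (-(x * t)) * (cos x + t * sin x)) * (1 + t ^ 2)⁻¹)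
      (rexp (-(x * t)) * sin x) x := by
    intro x _
    have h1 : HasDerivAt (fun x => rexp (-(x * t))) (rexp (-(x * t)) * (-(1 * t))) x :=
      (((hasDerivAt_id x).mul_const t).neg).exp
    have h2 : HasDerivAt (fun x => cos x + t * sin x) (-sin x + t * cos x) x :=
      (hasDerivAt_cos x).add ((hasDerivAt_sin x).const_mul t)
    refine ((h1.mul h2).neg.mul_const _).congr_deriv ?_
    have : (1 + t ^ 2) ≠ 0 := by positivity
    field_simp
    ring
  rw [intervalIntegral.integral_eq_sub_of_hasDerivAt hd
    (Continuous.intervalIntegrable (by fun_prop) _ _)]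
  simp
  ring

theorem integral_Ioi_exp_neg_mul {x : ℝ} (hx : 0 < x) :
    ∫ t in Set.Ioi (0 : ℝ), rexp (-(x * t)) = x⁻¹ := by
  have := integral_exp_mul_Ioi (a := -x) (by linarith) 0
  simp only [neg_mul, mul_zero, Real.exp_zero] at this
  rw [this, neg_div_neg_eq, one_div]

theorem integrableOn_Ioi_exp_neg_mul {x : ℝ} (hx : 0 < x) :
    IntegrableOn (fun t => rexp (-(x * t))) (Set.Ioi 0) := by
  have := integrableOn_exp_mul_Ioi (a := -x) (by linarith) 0
  simpa only [neg_mul] using this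

/-- Write `1 / x` as `∫₀^∞ e^{-xt} dt` and exchange the integrals; the inner integral in `x` is
elementary. -/
theorem sineIntegral_eq {T : ℝ} (hT : 0 < T) :
    sineIntegral T = ∫ t in Set.Ioi (0 : ℝ),
      ((1 + t ^ 2)⁻¹ - rexp (-(T * t)) * (cos T + t * sin T) * (1 + t ^ 2)⁻¹) := by
  have hint : Integrable (fun p : ℝ × ℝ => rexp (-(p.1 * p.2)) * sin p.1)
      ((volume.restrict (Set.Ioc 0 T)).prod (volume.restrict (Set.Ioi 0))) := by
    rw [integrable_prod_iff (Continuous.aestronglyMeasurable (by fun_prop))]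
    constructor
    · filter_upwards [ae_restrict_mem measurableSet_Ioc] with x hx
      exact (integrableOn_Ioi_exp_neg_mul hx.1).mul_const _
    · have : IntegrableOn (fun x => |sinc x|) (Set.Ioc 0 T) :=
        (continuous_sinc.abs.integrableOn_Icc).mono_set Set.Ioc_subset_Icc_self
      refine this.congr ?_
      filter_upwards [ae_restrict_mem measurableSet_Ioc] with x hx
      simp only [norm_mul, Real.norm_eq_abs, abs_exp]
      rw [integral_mul_const, integral_Ioi_exp_neg_mul hx.1, sinc_of_ne_zero hx.1.ne', abs_div,
        abs_of_pos hx.1]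
      ring
  rw [sineIntegral, intervalIntegral.integral_of_le hT.le]
  calc ∫ x in Set.Ioc 0 T, sinc x
      = ∫ x in Set.Ioc 0 T, ∫ t in Set.Ioi (0 : ℝ), rexp (-(x * t)) * sin x := by
        refine setIntegral_congr_fun measurableSet_Ioc fun x hx => ?_
        rw [integral_mul_const, integral_Ioi_exp_neg_mul hx.1, sinc_of_ne_zero hx.1.ne']
        ring
    _ = ∫ t in Set.Ioi (0 : ℝ), ∫ x in Set.Ioc 0 T, rexp (-(x * t)) * sin x :=
        integral_integral_swap hint
    _ = _ := by
        congr 1 with t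
        rw [← intervalIntegral.integral_of_le hT.le, integral_exp_neg_mul_mul_sin]

/-- In `sineIntegral_eq` the term `1 / (1 + t²)` integrates to `π / 2`, and the remainder is at most
`2 e^{-Tt}` because `1 + t ≤ 2 (1 + t²)`. -/
theorem abs_sineIntegral_sub_le {T : ℝ} (hT : 0 < T) : |sineIntegral T - π / 2| ≤ 2 / T := by
  have h1 : IntegrableOn (fun t : ℝ => (1 + t ^ 2)⁻¹) (Set.Ioi 0) :=
    integrable_inv_one_add_sq.integrableOn
  have hb : ∀ t ∈ Set.Ioi (0 : ℝ), ‖rexp (-(T * t)) * (cos T + t * sin T) * (1 + t ^ 2)⁻¹‖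
      ≤ 2 * rexp (-(T * t)) := by
    intro t ht
    have ht : 0 < t := ht
    have h2 : |cos T + t * sin T| ≤ 1 + t := by
      refine (abs_add_le _ _).trans (add_le_add (abs_cos_le_one _) ?_)
      rw [abs_mul, abs_of_pos ht]
      exact mul_le_of_le_one_right ht.le (abs_sin_le_one _)
    rw [norm_mul, norm_mul, Real.norm_eq_abs, Real.norm_eq_abs, Real.norm_eq_abs, abs_exp,
      abs_of_pos (by positivity : (0 : ℝ) < (1 + t ^ 2)⁻¹), mul_assoc, mul_comm 2]
    refine mul_le_mul_of_nonneg_left ?_ (Real.exp_pos _).le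
    rw [mul_inv_le_iff₀ (by positivity)]
    nlinarith [sq_nonneg (t - 1)]
  have hg : IntegrableOn (fun t => 2 * rexp (-(T * t))) (Set.Ioi 0) :=
    (integrableOn_Ioi_exp_neg_mul hT).const_mul 2
  have h2 : IntegrableOn (fun t => rexp (-(T * t)) * (cos T + t * sin T) * (1 + t ^ 2)⁻¹)
      (Set.Ioi 0) := by
    refine hg.mono' (Continuous.aestronglyMeasurable ?_) ?_
    · refine Continuous.mul (by fun_prop) (Continuous.inv₀ (by fun_prop) fun t => by positivity)
    · filter_upwards [ae_restrict_mem measurableSet_Ioi] with t ht using hb t ht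
  rw [sineIntegral_eq hT, integral_sub h1 h2, integral_Ioi_inv_one_add_sq, arctan_zero, sub_zero,
    sub_sub_cancel_left, abs_neg, ← Real.norm_eq_abs]
  refine (norm_integral_le_of_norm_le hg ?_).trans_eq ?_
  · filter_upwards [ae_restrict_mem measurableSet_Ioi] with t ht using hb t ht
  · rw [integral_const_mul, integral_Ioi_exp_neg_mul hT]
    rfl

/-- **Dirichlet integral** -/
theorem tendsto_sineIntegral_atTop : Tendsto sineIntegral atTop (𝓝 (π / 2)) := by
  rw [tendsto_iff_norm_sub_tendsto_zero]
  refine squeeze_zero' (.of_forall fun _ => norm_nonneg _) ?_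
    (tendsto_const_nhds (x := (2 : ℝ)).div_atTop tendsto_id)
  filter_upwards [eventually_gt_atTop 0] with T hT using abs_sineIntegral_sub_le hT

/-- A crude uniform bound: `|sinc| ≤ 1` handles `[0, 1]`, and beyond it the distance to `π / 2` is
at most `2`. -/
theorem abs_sineIntegral_le (t : ℝ) : |sineIntegral t| ≤ 4 := by
  have pos : ∀ t : ℝ, 0 ≤ t → |sineIntegral t| ≤ 4 := by
    intro t ht
    rcases le_or_gt t 1 with h | h
    · have := intervalIntegral.norm_integral_le_of_norm_le_const (a := 0) (b := t) (f := sinc)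
        (C := 1) (fun x _ => abs_sinc_le_one x)
      rw [sub_zero, abs_of_nonneg ht, one_mul] at this
      exact (this.trans h).trans (by norm_num)
    · have h1 := abs_sineIntegral_sub_le (by linarith : 0 < t)
      have h2 : 2 / t ≤ 2 := by rw [div_le_iff₀ (by linarith)]; linarith
      have h3 := abs_le.1 (h1.trans h2)
      have h4 := pi_le_four
      have h5 := pi_pos
      rw [abs_le]
      constructor <;> linarith
  rcases le_total 0 t with h | h
  · exact pos t h
  · rw [← abs_neg, ← sineIntegral_neg]
    exact pos _ (by linarith)

theorem integral_sin_mul_div {κ a b : ℝ} (ha : 0 < a) (hab : a ≤ b) :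
    ∫ r in a..b, sin (r * κ) / r = sineIntegral (b * κ) - sineIntegral (a * κ) := by
  rw [sineIntegral, sineIntegral, intervalIntegral.integral_interval_sub_left
    (continuous_sinc.intervalIntegrable _ _) (continuous_sinc.intervalIntegrable _ _),
    ← intervalIntegral.mul_integral_comp_mul_right, ← intervalIntegral.integral_const_mul]
  refine intervalIntegral.integral_congr fun r hr => ?_
  rw [Set.uIcc_of_le hab] at hr
  have hr0 : r ≠ 0 := (ha.trans_le hr.1).ne'
  rcases eq_or_ne κ 0 with rfl | h
  · simp
  · rw [sinc_of_ne_zero (mul_ne_zero hr0 h)]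
    field_simp

theorem tendsto_sineIntegral_mul_atTop (κ : ℝ) :
    Tendsto (fun R : ℝ => sineIntegral (R * κ)) atTop (𝓝 (SignType.sign κ * (π / 2))) := by
  rcases lt_trichotomy κ 0 with h | rfl | h
  · have := (tendsto_sineIntegral_atTop.comp (tendsto_id.atTop_mul_const (neg_pos.2 h))).neg
    simpa [Function.comp_def, sineIntegral_neg, sign_neg h] using this
  · simp [sineIntegral]
  · have := (tendsto_sineIntegral_atTop.comp (tendsto_id.atTop_mul_const h))
    simpa [Function.comp_def, sign_pos h] using this

theorem tendsto_integral_sin_mul_div (κ : ℝ) :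
    Tendsto (fun p : ℝ × ℝ => sineIntegral (p.2 * κ) - sineIntegral (p.1 * κ)) (𝓝[>] 0 ×ˢ atTop)
      (𝓝 (SignType.sign κ * (π / 2))) := by
  have h1 : Tendsto (fun ε : ℝ => sineIntegral (ε * κ)) (𝓝[>] 0) (𝓝 0) := by
    have : Continuous fun ε : ℝ => sineIntegral (ε * κ) :=
      continuous_sineIntegral.comp (by fun_prop)
    have := this.tendsto 0
    simp only [zero_mul, sineIntegral, intervalIntegral.integral_same] at this
    exact this.mono_left nhdsWithin_le_nhds
  simpa using ((tendsto_sineIntegral_mul_atTop κ).comp tendsto_snd).sub (h1.comp tendsto_fst)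

end DirichletIntegral
end

/-! ### Sign integrals over the circle and polar coordinates -/

noncomputable section

section Angular

open Real

theorem measurable_coe_sign : Measurable fun x : ℝ => ((SignType.sign x : SignType) : ℝ) := by
  have : (fun x : ℝ => ((SignType.sign x : SignType) : ℝ))
      = fun x => if 0 < x then 1 else if x < 0 then -1 else 0 := by
    ext x
    rw [sign_apply]
    split_ifs <;> simp
  rw [this]
  exact Measurable.ite measurableSet_Ioi measurable_const
    (Measurable.ite measurableSet_Iio measurable_const measurable_const)

theorem abs_coe_sign_le_one (x : ℝ) : |((SignType.sign x : SignType) : ℝ)| ≤ 1 := by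
  rcases lt_trichotomy x 0 with h | rfl | h <;> simp [*]

theorem integral_abs_cos : ∫ θ in (-π)..π, |cos θ| = 4 := by
  have hper : Function.Periodic (fun θ => |cos θ|) π := fun θ => by simp [cos_add_pi]
  have hi : ∀ a b : ℝ, IntervalIntegrable (fun θ => |cos θ|) volume a b :=
    fun a b => continuous_cos.abs.intervalIntegrable a b
  have h0 : ∫ θ in (-(π / 2))..(π / 2), |cos θ| = 2 := by
    have : ∫ θ in (-(π / 2))..(π / 2), |cos θ| = ∫ θ in (-(π / 2))..(π / 2), cos θ := by
      refine intervalIntegral.integral_congr fun θ hθ => ?_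
      rw [Set.uIcc_of_le (by linarith [pi_pos])] at hθ
      exact abs_of_nonneg (cos_nonneg_of_mem_Icc hθ)
    rw [this, integral_cos]
    simp
    norm_num
  have h1 : ∀ t : ℝ, ∫ θ in t..(t + π), |cos θ| = 2 := fun t => by
    rw [hper.intervalIntegral_add_eq t (-(π / 2)), show -(π / 2) + π = π / 2 by ring, h0]
  rw [← intervalIntegral.integral_add_adjacent_intervals (hi (-π) 0) (hi 0 π)]
  have h2 := h1 (-π)
  have h3 := h1 0
  rw [neg_add_cancel] at h2
  rw [zero_add] at h3
  rw [h2, h3]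
  norm_num

theorem cos_mul_sign_cos (θ : ℝ) : cos θ * SignType.sign (cos θ) = |cos θ| := by
  rw [mul_comm, sign_mul_self]

theorem intervalIntegrable_mul_sign {g h : ℝ → ℝ} (hg : Continuous g) (hh : Continuous h)
    (a b : ℝ) :
    IntervalIntegrable (fun θ => g θ * SignType.sign (h θ)) volume a b := by
  rw [intervalIntegrable_iff]
  exact Integrable.mul_bdd (c := 1) (intervalIntegrable_iff.1 (hg.intervalIntegrable a b))
    (measurable_coe_sign.comp hh.measurable).aestronglyMeasurable
    (.of_forall fun _ => abs_coe_sign_le_one _)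

theorem integral_sin_mul_sign_cos : ∫ θ in (-π)..π, sin θ * SignType.sign (cos θ) = 0 := by
  have := intervalIntegral.integral_comp_neg (a := -π) (b := π)
    (fun θ => sin θ * (SignType.sign (cos θ) : ℝ))
  simp only [sin_neg, cos_neg, neg_neg, neg_mul, intervalIntegral.integral_neg] at this
  linarith

/-- Shift `θ` by `φ`, using periodicity, and expand `cos (θ + φ)`: the `|cos|` part contributes `4
cos φ`, and the remaining part is odd. -/
theorem integral_cos_mul_sign_cos_sub (φ : ℝ) :
    ∫ θ in (-π)..π, cos θ * SignType.sign (cos (θ - φ)) = 4 * cos φ := by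
  have hper : Function.Periodic (fun θ => cos (θ + φ) * (SignType.sign (cos θ) : ℝ)) (2 * π) :=
    fun θ => by simp only [cos_add_two_pi, add_right_comm θ (2 * π) φ]
  have h1 := intervalIntegral.integral_comp_sub_right (a := -π) (b := π)
    (fun θ => cos (θ + φ) * (SignType.sign (cos θ) : ℝ)) φ
  simp only [sub_add_cancel] at h1
  have h2 := hper.intervalIntegral_add_eq (-π - φ) (-π)
  rw [show -π - φ + 2 * π = π - φ by ring, show -π + 2 * π = π by ring] at h2
  rw [h1, h2]
  have h3 : ∀ θ, cos (θ + φ) * (SignType.sign (cos θ) : ℝ)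
      = cos φ * |cos θ| - sin φ * (sin θ * SignType.sign (cos θ)) := fun θ => by
    rw [cos_add, ← cos_mul_sign_cos]; ring
  simp_rw [h3]
  rw [intervalIntegral.integral_sub ((continuous_cos.abs.intervalIntegrable _ _).const_mul _)
    ((intervalIntegrable_mul_sign continuous_sin continuous_cos _ _).const_mul _),
    intervalIntegral.integral_const_mul, intervalIntegral.integral_const_mul, integral_abs_cos,
    integral_sin_mul_sign_cos]
  ring

theorem integral_sin_mul_sign_cos_sub (φ : ℝ) :
    ∫ θ in (-π)..π, sin θ * SignType.sign (cos (θ - φ)) = 4 * sin φ := by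
  have hper : Function.Periodic (fun θ => sin (θ + φ) * (SignType.sign (cos θ) : ℝ)) (2 * π) :=
    fun θ => by simp only [cos_add_two_pi, sin_add_two_pi, add_right_comm θ (2 * π) φ]
  have h1 := intervalIntegral.integral_comp_sub_right (a := -π) (b := π)
    (fun θ => sin (θ + φ) * (SignType.sign (cos θ) : ℝ)) φ
  simp only [sub_add_cancel] at h1
  have h2 := hper.intervalIntegral_add_eq (-π - φ) (-π)
  rw [show -π - φ + 2 * π = π - φ by ring, show -π + 2 * π = π by ring] at h2
  rw [h1, h2]
  have h3 : ∀ θ, sin (θ + φ) * (SignType.sign (cos θ) : ℝ)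
      = sin φ * |cos θ| + cos φ * (sin θ * SignType.sign (cos θ)) := fun θ => by
    rw [sin_add, ← cos_mul_sign_cos]; ring
  simp_rw [h3]
  rw [intervalIntegral.integral_add ((continuous_cos.abs.intervalIntegrable _ _).const_mul _)
    ((intervalIntegrable_mul_sign continuous_sin continuous_cos _ _).const_mul _),
    intervalIntegral.integral_const_mul, intervalIntegral.integral_const_mul, integral_abs_cos,
    integral_sin_mul_sign_cos]
  ring

theorem inner_direction (θ : ℝ) (k : Plane) :
    inner ℝ (direction θ) k = cos θ * k 0 + sin θ * k 1 := by
  simp [direction, PiLp.inner_apply, Fin.sum_univ_two, mul_comm]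

theorem norm_direction (θ : ℝ) : ‖direction θ‖ = 1 := by
  simp [direction, EuclideanSpace.norm_eq, Fin.sum_univ_two]

theorem continuous_direction : Continuous direction := by
  unfold direction
  refine (PiLp.continuous_toLp 2 _).comp (continuous_pi fun i => ?_)
  fin_cases i
  · exact continuous_cos
  · exact continuous_sin

theorem exists_eq_norm_smul_direction (k : Plane) : ∃ φ : ℝ, k = ‖k‖ • direction φ := by
  let z : ℂ := ⟨k 0, k 1⟩
  have hz : ‖z‖ = ‖k‖ := by
    rw [Complex.norm_def, Complex.normSq_mk, EuclideanSpace.norm_eq]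
    simp [Fin.sum_univ_two, sq]
  refine ⟨z.arg, ?_⟩
  ext i
  fin_cases i
  · simpa [direction, hz, z] using (Complex.norm_mul_cos_arg z).symm
  · simpa [direction, hz, z] using (Complex.norm_mul_sin_arg z).symm

theorem inner_direction_direction (θ φ : ℝ) :
    inner ℝ (direction θ) (direction φ) = cos (θ - φ) := by
  rw [inner_direction, cos_sub]
  simp [direction]

/-- `∫ u_l sign ⟨u, k⟩` over the unit circle is `4 k_l / ‖k‖`. -/
theorem integral_direction_mul_sign (l : Fin 2) (k : Plane) :
    ∫ θ in (-π)..π, direction θ l * SignType.sign (inner ℝ (direction θ) k) = 4 * (k l / ‖k‖) := by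
  rcases eq_or_ne k 0 with rfl | hk
  · simp
  have hk0 : 0 < ‖k‖ := norm_pos_iff.2 hk
  obtain ⟨φ, hφ⟩ := exists_eq_norm_smul_direction k
  have h1 : ∀ θ, SignType.sign (inner ℝ (direction θ) k) = SignType.sign (cos (θ - φ)) := by
    intro θ
    conv_lhs => rw [hφ]
    rw [real_inner_smul_right, inner_direction_direction, sign_mul, sign_pos hk0, one_mul]
  have h2 : k l / ‖k‖ = direction φ l := by
    conv_lhs => rw [hφ]
    rw [PiLp.smul_apply, smul_eq_mul, norm_smul, norm_direction, norm_norm, mul_one,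
      mul_div_cancel_left₀ _ hk0.ne']
  simp_rw [h1, h2]
  fin_cases l
  · simpa [direction] using integral_cos_mul_sign_cos_sub φ
  · simpa [direction] using integral_sin_mul_sign_cos_sub φ

/-- Integration in polar coordinates on the Euclidean plane. -/
theorem integral_plane_eq_polar (g : Plane → ℝ) :
    ∫ y, g y = ∫ p in Set.Ioi (0 : ℝ) ×ˢ Set.Ioo (-π) π, p.1 • g (p.1 • direction p.2) := by
  rw [← (Complex.orthonormalBasisOneI.repr.measurePreserving).integral_comp
    Complex.orthonormalBasisOneI.repr.toHomeomorph.measurableEmbedding,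
    ← Complex.integral_comp_polarCoord_symm]
  congr 1 with p
  congr 2
  ext i
  fin_cases i
  · simp [direction, Complex.polarCoord_symm_apply, Complex.orthonormalBasisOneI_repr_apply,
      -Complex.ofReal_cos, -Complex.ofReal_sin]
  · simp [direction, Complex.polarCoord_symm_apply, Complex.orthonormalBasisOneI_repr_apply,
      -Complex.ofReal_cos, -Complex.ofReal_sin]

end Angular
end

/-! ### Symbol of the truncated Riesz kernel -/

noncomputable section

section RieszKernel

open Real Complex
open scoped ComplexConjugate

/-- The Riesz kernel `y_l / (2π ‖y‖³)` truncated to the annulus `ε < ‖y‖ < R` (and zero if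
`ε ≤ 0`). -/
def rieszKernel (l : Fin 2) (p : ℝ × ℝ) : Plane → ℝ :=
  Set.indicator {y | 0 < p.1 ∧ p.1 < ‖y‖ ∧ ‖y‖ < p.2}
    fun y => 1 / (2 * π) * (y l / ‖y‖ ^ 3)

theorem measurableSet_annulus (ε R : ℝ) : MeasurableSet {y : Plane | 0 < ε ∧ ε < ‖y‖ ∧ ‖y‖ < R} :=
  (MeasurableSet.const _).inter
    ((measurableSet_lt measurable_const measurable_norm).inter
      (measurableSet_lt measurable_norm measurable_const))

/-- Integrability for every index, not only eventually, is what the limit theorems for moving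
averages ask for; the convention that the kernel is zero for `ε ≤ 0` makes it available. -/
theorem integrable_rieszKernel (l : Fin 2) (p : ℝ × ℝ) : Integrable (rieszKernel l p) := by
  rcases le_or_gt p.1 0 with h | h
  · have : rieszKernel l p = 0 := by
      ext y
      exact Set.indicator_of_notMem (fun hy => absurd hy.1 h.not_gt) _
    rw [this]
    exact integrable_zero _ _ _
  · rw [rieszKernel, integrable_indicator_iff (measurableSet_annulus _ _)]
    have hm : Measurable fun y : Plane => 1 / (2 * π) * (y l / ‖y‖ ^ 3) := by
      have : Continuous fun y : Plane => y l := by fun_prop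
      exact ((this.measurable).div (measurable_norm.pow_const 3)).const_mul _
    refine Measure.integrableOn_of_bounded (M := 1 / (2 * π) * (p.1 ^ 2)⁻¹) ?_ hm.aestronglyMeasurable ?_
    · refine ((measure_mono fun y hy => ?_).trans_lt
        (measure_ball_lt_top (μ := volume) (x := (0 : Plane)) (r := p.2))).ne
      exact mem_ball_zero_iff.2 hy.2.2
    · filter_upwards [ae_restrict_mem (measurableSet_annulus _ _)] with y hy
      have hy0 : 0 < ‖y‖ := h.trans hy.2.1
      rw [norm_mul, norm_div _ (‖y‖ ^ 3), norm_pow, norm_norm, Real.norm_of_nonneg (by positivity)]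
      refine mul_le_mul_of_nonneg_left ?_ (by positivity)
      calc ‖y l‖ / ‖y‖ ^ 3 ≤ ‖y‖ / ‖y‖ ^ 3 := by
            gcongr
            exact PiLp.norm_apply_le y l
        _ = (‖y‖ ^ 2)⁻¹ := by field_simp
        _ ≤ _ := by
            gcongr
            exact hy.2.1.le

theorem rieszKernel_neg (l : Fin 2) (p : ℝ × ℝ) (y : Plane) :
    rieszKernel l p (-y) = -rieszKernel l p y := by
  by_cases h : 0 < p.1 ∧ p.1 < ‖y‖ ∧ ‖y‖ < p.2
  · rw [rieszKernel, Set.indicator_of_mem (by simpa using h), Set.indicator_of_mem (by exact h)]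
    simp only [norm_neg, PiLp.neg_apply]
    ring
  · rw [rieszKernel, Set.indicator_of_notMem (by simpa using h),
      Set.indicator_of_notMem (by exact h), neg_zero]

theorem truncatedRiesz_eq_movingAverage {Ω : Type*} [MeasurableSpace Ω] {P : Measure Ω}
    (f : RandomField P) (l : Fin 2) (x : Plane) {p : ℝ × ℝ} (hp : 0 < p.1) :
    truncatedRiesz l f x p.1 p.2 = movingAverage (rieszKernel l p) f x := by
  have hm : MeasurableSet {y : Plane | p.1 < ‖x - y‖ ∧ ‖x - y‖ < p.2} :=
    (measurableSet_lt measurable_const (measurable_const.sub measurable_id).norm).inter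
      (measurableSet_lt (measurable_const.sub measurable_id).norm measurable_const)
  rw [truncatedRiesz, movingAverage, ← integral_indicator hm, ← integral_smul,
    ← integral_add_left_eq_self _ x]
  congr 1 with y
  have h0 : ‖x - (x + y)‖ = ‖y‖ := by rw [sub_add_cancel_left, norm_neg]
  by_cases h : p.1 < ‖y‖ ∧ ‖y‖ < p.2
  · rw [Set.indicator_of_mem (by simpa using h), rieszKernel,
      Set.indicator_of_mem (by exact ⟨hp, h⟩), smul_smul, h0]
    simp
  · rw [Set.indicator_of_notMem (by simpa using h), rieszKernel,
      Set.indicator_of_notMem (by exact fun h' => h h'.2), smul_zero, zero_smul]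

/-- The real symbol `k_l / ‖k‖`; the Fourier multiplier of the Riesz transform is `i` times it. -/
def rieszSymbol (l : Fin 2) (k : Plane) : ℝ := k l / ‖k‖

theorem kernelTransform_of_odd {K : Plane → ℝ} (hK : Integrable K) (hodd : ∀ y, K (-y) = -K y)
    (k : Plane) :
    kernelTransform K k = I * ((∫ y, K y * Real.sin (inner ℝ k y) : ℝ) : ℂ) := by
  have hint : Integrable fun y => (K y : ℂ) * cexp (inner ℝ k y * I) := by
    refine (hK.ofReal (𝕜 := ℂ)).mul_bdd (c := 1)
      (show Continuous fun y => cexp (inner ℝ k y * I) by fun_prop).aestronglyMeasurable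
      (.of_forall fun y => ?_)
    rw [norm_exp_ofReal_mul_I]
  have him : (kernelTransform K k).im = ∫ y, K y * Real.sin (inner ℝ k y) := by
    refine (integral_im hint).symm.trans ?_
    congr 1 with y
    rw [RCLike.im_eq_complex_im, Complex.im_ofReal_mul, Complex.exp_ofReal_mul_I_im]
  have hre : (kernelTransform K k).re = 0 := by
    have h1 : (kernelTransform K k).re = ∫ y, K y * Real.cos (inner ℝ k y) := by
      refine (integral_re hint).symm.trans ?_
      congr 1 with y
      rw [RCLike.re_eq_complex_re, Complex.re_ofReal_mul, Complex.exp_ofReal_mul_I_re]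
    have h2 := integral_neg_eq_self (fun y => K y * Real.cos (inner ℝ k y)) volume
    simp only [hodd, inner_neg_right, Real.cos_neg, neg_mul, integral_neg] at h2
    linarith
  rw [← him]
  apply Complex.ext <;> simp [hre]

/-- In polar coordinates the kernel is `r⁻²` times an angular factor, so with the Jacobian `r` the
radial integrand is `sin (r κ) / r`, where `κ` is the inner product of `direction θ` and `k`. -/
theorem integral_rieszKernel_mul_sin (l : Fin 2) {p : ℝ × ℝ} (hp : 0 < p.1) (hp' : p.1 ≤ p.2)
    (k : Plane) :
    ∫ y, rieszKernel l p y * Real.sin (inner ℝ k y)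
      = 1 / (2 * π) * ∫ θ in (-π)..π, direction θ l *
        (sineIntegral (p.2 * inner ℝ (direction θ) k) -
          sineIntegral (p.1 * inner ℝ (direction θ) k)) := by
  set G : ℝ × ℝ → ℝ := fun q =>
    1 / (2 * π) * (direction q.2 l * (Real.sin (q.1 * inner ℝ (direction q.2) k) / q.1)) with hG
  have hIoo : MeasurableSet (Set.Ioo p.1 p.2 ×ˢ (Set.univ : Set ℝ)) :=
    measurableSet_Ioo.prod MeasurableSet.univ
  have hd : Continuous fun q : ℝ × ℝ => direction q.2 := continuous_direction.comp continuous_snd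
  have hGi : IntegrableOn G (Set.Ioo p.1 p.2 ×ˢ Set.Ioo (-π) π) (volume.prod volume) := by
    have hc : ContinuousOn G (Set.Icc p.1 p.2 ×ˢ Set.Icc (-π) π) := by
      refine continuousOn_const.mul ((Continuous.continuousOn (by fun_prop)).mul
        (ContinuousOn.div (Continuous.continuousOn (by fun_prop)) continuousOn_fst ?_))
      rintro q ⟨hq, -⟩
      exact (hp.trans_le hq.1).ne'
    exact (hc.integrableOn_compact (isCompact_Icc.prod isCompact_Icc)).mono_set
      (Set.prod_mono Set.Ioo_subset_Icc_self Set.Ioo_subset_Icc_self)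
  rw [integral_plane_eq_polar]
  have h1 : ∫ q in Set.Ioi (0 : ℝ) ×ˢ Set.Ioo (-π) π, q.1 • (rieszKernel l p (q.1 • direction q.2)
        * Real.sin (inner ℝ k (q.1 • direction q.2)))
      = ∫ q in Set.Ioi (0 : ℝ) ×ˢ Set.Ioo (-π) π,
        (Set.Ioo p.1 p.2 ×ˢ (Set.univ : Set ℝ)).indicator G q := by
    refine setIntegral_congr_fun (measurableSet_Ioi.prod measurableSet_Ioo) fun q hq => ?_
    have hq0 : 0 < q.1 := hq.1
    have hn : ‖q.1 • direction q.2‖ = q.1 := by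
      rw [norm_smul, norm_direction, mul_one, Real.norm_of_nonneg hq0.le]
    by_cases h : p.1 < q.1 ∧ q.1 < p.2
    · rw [Set.indicator_of_mem (by exact ⟨h, trivial⟩), rieszKernel,
        Set.indicator_of_mem (by simpa [hn] using ⟨hp, h⟩), hn, hG, PiLp.smul_apply,
        real_inner_smul_right, real_inner_comm]
      simp only [smul_eq_mul]
      field_simp
    · rw [Set.indicator_of_notMem (by exact fun h' => h h'.1), rieszKernel,
        Set.indicator_of_notMem (by simpa [hn, hp] using h), zero_mul, smul_zero]
  rw [h1, setIntegral_indicator hIoo, Set.prod_inter_prod, Set.inter_univ,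
    Set.inter_eq_right.2 (show Set.Ioo p.1 p.2 ⊆ Set.Ioi 0 from fun r hr => hp.trans hr.1), Measure.volume_eq_prod,
    ← setIntegral_prod_swap, setIntegral_prod (fun z => G z.swap) hGi.swap,
    intervalIntegral.integral_of_le (by linarith [pi_pos]), integral_Ioc_eq_integral_Ioo,
    ← integral_const_mul]
  refine setIntegral_congr_fun measurableSet_Ioo fun θ _ => ?_
  simp only [hG, Prod.swap_prod_mk]
  rw [integral_const_mul, integral_const_mul, ← integral_Ioc_eq_integral_Ioo,
    ← intervalIntegral.integral_of_le hp', integral_sin_mul_div hp hp']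

theorem abs_direction_apply_le (θ : ℝ) (l : Fin 2) : |direction θ l| ≤ 1 :=
  (PiLp.norm_apply_le (direction θ) l).trans_eq (norm_direction θ)

/-- Each sine integral is at most `4` in absolute value, and the length `2π` of the circle cancels
the prefactor. -/
theorem norm_kernelTransform_rieszKernel_le (l : Fin 2) {p : ℝ × ℝ} (hp : 0 < p.1)
    (hp' : p.1 ≤ p.2) (k : Plane) : ‖kernelTransform (rieszKernel l p) k‖ ≤ 8 := by
  rw [kernelTransform_of_odd (integrable_rieszKernel l p) (rieszKernel_neg l p),
    integral_rieszKernel_mul_sin l hp hp', norm_mul, norm_I, one_mul, norm_real, norm_mul,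
    Real.norm_of_nonneg (by positivity)]
  have := intervalIntegral.norm_integral_le_of_norm_le_const (a := -π) (b := π) (C := 8)
    (f := fun θ => direction θ l * (sineIntegral (p.2 * inner ℝ (direction θ) k) -
          sineIntegral (p.1 * inner ℝ (direction θ) k))) fun θ _ => by
      rw [norm_mul]
      refine (mul_le_mul (abs_direction_apply_le θ l) (d := 4 + 4) ?_ (norm_nonneg _)
        zero_le_one).trans_eq (by norm_num)
      exact (norm_sub_le _ _).trans (add_le_add (abs_sineIntegral_le _) (abs_sineIntegral_le _))
  rw [sub_neg_eq_add, abs_of_pos (by positivity)] at this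
  refine (mul_le_mul_of_nonneg_left this (by positivity)).trans_eq ?_
  have := pi_pos
  field_simp
  norm_num

theorem eventually_annulus :
    ∀ᶠ p : ℝ × ℝ in 𝓝[>] 0 ×ˢ atTop, 0 < p.1 ∧ p.1 ≤ p.2 := by
  have h1 : ∀ᶠ ε : ℝ in 𝓝[>] 0, 0 < ε ∧ ε ≤ 1 := by
    filter_upwards [Ioc_mem_nhdsGT (zero_lt_one' ℝ)] with ε hε using hε
  filter_upwards [h1.prod_mk (eventually_ge_atTop (1 : ℝ))] with p hp
  exact ⟨hp.1.1, hp.1.2.trans hp.2⟩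

theorem eventually_norm_kernelTransform_rieszKernel_le (l : Fin 2) :
    ∀ᶠ p : ℝ × ℝ in 𝓝[>] 0 ×ˢ atTop, ∀ k, ‖kernelTransform (rieszKernel l p) k‖ ≤ 8 := by
  filter_upwards [eventually_annulus] with p hp k
  exact norm_kernelTransform_rieszKernel_le l hp.1 hp.2 k

/-- The radial integrals tend boundedly to `π / 2` times a sign, and the angular integral of the
sign is `4 k_l / ‖k‖`. The constants match: `1 / (2π) · π / 2 · 4 = 1`. -/
theorem tendsto_kernelTransform_rieszKernel (l : Fin 2) (k : Plane) :
    Tendsto (fun p => kernelTransform (rieszKernel l p) k) (𝓝[>] 0 ×ˢ atTop)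
      (𝓝 (I * (rieszSymbol l k : ℂ))) := by
  have h1 : Tendsto (fun p : ℝ × ℝ => ∫ θ in (-π)..π, direction θ l *
        (sineIntegral (p.2 * inner ℝ (direction θ) k) -
          sineIntegral (p.1 * inner ℝ (direction θ) k))) (𝓝[>] 0 ×ˢ atTop)
      (𝓝 (∫ θ in (-π)..π, direction θ l *
        (SignType.sign (inner ℝ (direction θ) k) * (π / 2)))) := by
    refine intervalIntegral.tendsto_integral_filter_of_dominated_convergence (fun _ => 8)
      (.of_forall fun p => ?_) (.of_forall fun p => .of_forall fun θ _ => ?_)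
      (continuous_const.intervalIntegrable _ _) (.of_forall fun θ _ => ?_)
    · have h2 := continuous_direction
      have h3 := continuous_sineIntegral
      exact Continuous.aestronglyMeasurable (by fun_prop)
    · rw [norm_mul]
      refine (mul_le_mul (abs_direction_apply_le θ l) (d := 4 + 4) ?_ (norm_nonneg _)
        zero_le_one).trans_eq (by norm_num)
      exact (norm_sub_le _ _).trans (add_le_add (abs_sineIntegral_le _) (abs_sineIntegral_le _))
    · exact (tendsto_integral_sin_mul_div _).const_mul _
  have h2 : 1 / (2 * π) * (∫ θ in (-π)..π, direction θ l *
        (SignType.sign (inner ℝ (direction θ) k) * (π / 2))) = rieszSymbol l k := by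
    simp_rw [← mul_assoc]
    rw [intervalIntegral.integral_mul_const, integral_direction_mul_sign, rieszSymbol]
    have := pi_pos
    field_simp
    norm_num
  have h3 := h1.const_mul (1 / (2 * π))
  rw [h2] at h3
  refine (((continuous_ofReal.tendsto _).comp h3).const_mul I).congr' ?_
  filter_upwards [eventually_annulus] with p hp
  rw [kernelTransform_of_odd (integrable_rieszKernel l p) (rieszKernel_neg l p),
    integral_rieszKernel_mul_sin l hp.1 hp.2]
  rfl

end RieszKernel
end

/-! ### Spectral measure of the field and of its Riesz transforms -/

noncomputable section

section RandomFieldSpectrum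

open Complex
open scoped ComplexConjugate

variable {Ω : Type*} [MeasurableSpace Ω] {P : Measure Ω}

theorem integrable_mul_Lp (a b : Lp ℝ 2 P) : Integrable (fun ω => a ω * b ω) P := by
  refine (L2.integrable_inner (𝕜 := ℝ) b a).congr (.of_forall fun ω => ?_)
  simp

theorem integral_mul_Lp (a b : Lp ℝ 2 P) : ∫ ω, a ω * b ω ∂P = inner ℝ a b := by
  rw [L2.inner_def]
  congr 1 with ω
  simp [mul_comm]

theorem fieldCov_eq_inner (f : RandomField P) (x ξ : Plane) :
    fieldCov f x ξ = inner ℝ (f x) (f (x - ξ)) := integral_mul_Lp _ _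

theorem inner_eq_fieldCov {f : RandomField P} (hstat : IsStationaryField f) (x y : Plane) :
    inner ℝ (f x) (f y) = fieldCov f 0 (x - y) := by
  rw [hstat 0 x, fieldCov_eq_inner, sub_sub_cancel]

/-- `F` is a spectral measure of the stationary field `f`. -/
structure IsSpectralMeasure (f : RandomField P) (F : Measure Plane) : Prop where
  finite : IsFiniteMeasure F
  continuous : Continuous f
  inner_eq : ∀ x y, inner ℝ (f x) (f y) = fieldCov f 0 (x - y)
  charFun_eq : ∀ ξ, charFun F ξ = (fieldCov f 0 ξ : ℂ)

theorem exists_isSpectralMeasure {f : RandomField P} (hcont : Continuous f)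
    (hstat : IsStationaryField f) : ∃ F, IsSpectralMeasure f F := by
  obtain ⟨F, h1, h2⟩ := exists_charFun_eq_of_stationary hcont (inner_eq_fieldCov hstat)
  exact ⟨F, h1, hcont, inner_eq_fieldCov hstat, h2⟩

variable {f : RandomField P} {F : Measure Plane}

theorem isRieszTransform_iff (l : Fin 2) (f g : RandomField P) :
    IsRieszTransform l f g ↔ ∀ x, Tendsto (fun p => movingAverage (rieszKernel l p) f x)
      (𝓝[>] 0 ×ˢ atTop) (𝓝 (g x)) := by
  refine forall_congr' fun x => tendsto_congr' ?_
  filter_upwards [eventually_annulus] with p hp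
  exact truncatedRiesz_eq_movingAverage f l x hp.1

theorem IsSpectralMeasure.exists_isRieszTransform (h : IsSpectralMeasure f F) (l : Fin 2) :
    ∃ g, IsRieszTransform l f g := by
  have := h.finite
  choose g hg using exists_tendsto_movingAverage h.continuous h.inner_eq h.charFun_eq
    (integrable_rieszKernel l) (eventually_norm_kernelTransform_rieszKernel_le l)
    (tendsto_kernelTransform_rieszKernel l)
  exact ⟨g, (isRieszTransform_iff l f g).2 hg⟩

theorem IsSpectralMeasure.inner_riesz_riesz (h : IsSpectralMeasure f F) {l l' : Fin 2}
    {g g' : RandomField P} (hg : IsRieszTransform l f g) (hg' : IsRieszTransform l' f g')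
    (x y : Plane) :
    ((inner ℝ (g x) (g' y) : ℝ) : ℂ)
      = spectralIntegral F (x - y) (fun k => ((rieszSymbol l k * rieszSymbol l' k : ℝ) : ℂ)) := by
  have := h.finite
  rw [inner_limit_movingAverage_limit_movingAverage h.continuous h.inner_eq h.charFun_eq
    (integrable_rieszKernel l) (integrable_rieszKernel l')
    (eventually_norm_kernelTransform_rieszKernel_le l)
    (eventually_norm_kernelTransform_rieszKernel_le l')
    (tendsto_kernelTransform_rieszKernel l) (tendsto_kernelTransform_rieszKernel l')
    ((isRieszTransform_iff l f g).1 hg x) ((isRieszTransform_iff l' f g').1 hg' y)]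
  congr 1 with k
  rw [map_mul, conj_I, conj_ofReal]
  push_cast
  linear_combination (-(rieszSymbol l k : ℂ) * rieszSymbol l' k) * I_sq

theorem IsSpectralMeasure.inner_riesz_field (h : IsSpectralMeasure f F) {l : Fin 2}
    {g : RandomField P} (hg : IsRieszTransform l f g) (x y : Plane) :
    ((inner ℝ (g x) (f y) : ℝ) : ℂ)
      = spectralIntegral F (x - y) (fun k => I * (rieszSymbol l k : ℂ)) := by
  have := h.finite
  exact inner_limit_movingAverage h.continuous h.inner_eq h.charFun_eq
    (integrable_rieszKernel l) (eventually_norm_kernelTransform_rieszKernel_le l)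
    (tendsto_kernelTransform_rieszKernel l) ((isRieszTransform_iff l f g).1 hg x) y

/-- The cross-covariance of a field and its Riesz transform is odd. -/
theorem IsSpectralMeasure.inner_field_riesz_add (h : IsSpectralMeasure f F) {l : Fin 2}
    {g : RandomField P} (hg : IsRieszTransform l f g) (x y : Plane) :
    inner ℝ (f x) (g y) + inner ℝ (g x) (f y) = (0 : ℝ) := by
  have h1 := h.inner_riesz_field hg y x
  have h2 := congrArg conj (h.inner_riesz_field hg x y)
  rw [conj_ofReal, conj_spectralIntegral, neg_sub] at h2
  -- The symbol is purely imaginary, so conjugation changes its sign.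
  have h3 : spectralIntegral F (y - x) (fun k => conj (I * (rieszSymbol l k : ℂ)))
      = -spectralIntegral F (y - x) (fun k => I * (rieszSymbol l k : ℂ)) := by
    rw [spectralIntegral, spectralIntegral, ← integral_neg]
    congr 1 with k
    rw [map_mul, conj_I, conj_ofReal]
    ring
  rw [h3, ← h1, ← ofReal_neg] at h2
  have h4 := ofReal_injective h2
  rw [real_inner_comm, h4, add_neg_cancel]

theorem abs_rieszSymbol_le (l : Fin 2) (k : Plane) : |rieszSymbol l k| ≤ 1 := by
  rw [rieszSymbol, abs_div, abs_norm]
  exact div_le_one_of_le₀ (PiLp.norm_apply_le k l) (norm_nonneg _)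

theorem measurable_rieszSymbol (l : Fin 2) : Measurable (rieszSymbol l) := by
  have : Continuous fun y : Plane => y l := by fun_prop
  exact this.measurable.div measurable_norm

/-- The exclusion of `k = 0` is essential, since both symbols are zero there by the convention for
division by zero. This is where spectral mass at the origin would be lost. -/
theorem rieszSymbol_sq_add_sq {k : Plane} (hk : k ≠ 0) :
    rieszSymbol 0 k * rieszSymbol 0 k + rieszSymbol 1 k * rieszSymbol 1 k = 1 := by
  have h1 : ‖k‖ ^ 2 = k 0 ^ 2 + k 1 ^ 2 := by
    rw [EuclideanSpace.norm_sq_eq, Fin.sum_univ_two]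
    simp
  have h2 : ‖k‖ ≠ 0 := norm_ne_zero_iff.2 hk
  rw [rieszSymbol, rieszSymbol]
  field_simp
  linarith

theorem integrable_spectralIntegrand [IsFiniteMeasure F] (z : Plane) {u : Plane → ℝ}
    (hu : Measurable u) {B : ℝ} (hB : ∀ k, |u k| ≤ B) :
    Integrable (fun k => cexp (inner ℝ k z * I) * (u k : ℂ)) F := by
  refine Integrable.of_bound (C := B) ?_ (.of_forall fun k =>
    norm_spectralIntegrand_le _ _ ((norm_real _).trans_le (hB k)) le_rfl)
  exact (show Continuous fun k : Plane => cexp (inner ℝ k z * I) by fun_prop).aestronglyMeasurable.mul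
    (Complex.measurable_ofReal.comp hu).aestronglyMeasurable

theorem abs_rieszSymbol_mul_le (l l' : Fin 2) (k : Plane) :
    |rieszSymbol l k * rieszSymbol l' k| ≤ 1 := by
  rw [abs_mul]
  exact mul_le_one₀ (abs_rieszSymbol_le l k) (abs_nonneg _) (abs_rieszSymbol_le l' k)

/-- Without spectral mass at the origin, the Riesz transforms jointly preserve covariances. -/
theorem IsSpectralMeasure.inner_riesz_add_inner_riesz (h : IsSpectralMeasure f F) (h0 : F {0} = 0)
    {g₀ g₁ : RandomField P} (hg₀ : IsRieszTransform 0 f g₀) (hg₁ : IsRieszTransform 1 f g₁)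
    (x y : Plane) :
    inner ℝ (g₀ x) (g₀ y) + inner ℝ (g₁ x) (g₁ y) = inner ℝ (f x) (f y) := by
  have := h.finite
  apply ofReal_injective
  rw [ofReal_add, h.inner_riesz_riesz hg₀ hg₀, h.inner_riesz_riesz hg₁ hg₁, h.inner_eq,
    ← h.charFun_eq, ← spectralIntegral_one, spectralIntegral, spectralIntegral, spectralIntegral,
    ← integral_add]
  · refine integral_congr_ae ?_
    have : ∀ᵐ k ∂F, k ≠ 0 := by
      rw [ae_iff]
      simpa using h0
    filter_upwards [this] with k hk
    rw [← mul_add, ← ofReal_add, rieszSymbol_sq_add_sq hk, ofReal_one]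
  · exact integrable_spectralIntegrand _ ((measurable_rieszSymbol 0).mul (measurable_rieszSymbol 0))
      (abs_rieszSymbol_mul_le 0 0)
  · exact integrable_spectralIntegrand _ ((measurable_rieszSymbol 1).mul (measurable_rieszSymbol 1))
      (abs_rieszSymbol_mul_le 1 1)

/-- A linear combination of the Riesz transforms vanishes exactly if the spectral measure lives on
the line where its symbol vanishes. -/
theorem IsSpectralMeasure.smul_riesz_add_smul_riesz_eq_zero_iff (h : IsSpectralMeasure f F)
    {g₀ g₁ : RandomField P} (hg₀ : IsRieszTransform 0 f g₀) (hg₁ : IsRieszTransform 1 f g₁)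
    (a b : ℝ) (x : Plane) :
    a • g₀ x + b • g₁ x = 0 ↔ ∀ᵐ k ∂F, a * k 0 + b * k 1 = 0 := by
  have := h.finite
  have hint : ∀ l l' : Fin 2, Integrable (fun k => rieszSymbol l k * rieszSymbol l' k) F :=
    fun l l' => Integrable.of_bound (C := 1)
      ((measurable_rieszSymbol l).mul (measurable_rieszSymbol l')).aestronglyMeasurable
      (.of_forall fun k => abs_rieszSymbol_mul_le l l' k)
  have hr : ∀ {l l' : Fin 2} {g g' : RandomField P}, IsRieszTransform l f g →
      IsRieszTransform l' f g' →
      inner ℝ (g x) (g' x) = ∫ k, rieszSymbol l k * rieszSymbol l' k ∂F := by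
    intro l l' g g' hg hg'
    apply ofReal_injective
    rw [h.inner_riesz_riesz hg hg', sub_self, spectralIntegral, ← integral_complex_ofReal]
    simp
  -- The symbol of the combination is real up to the factor `i`, so its squared norm is the integral
  -- of a nonnegative function, and it vanishes exactly when that function does almost everywhere.
  have key : ‖a • g₀ x + b • g₁ x‖ ^ 2 = ∫ k, (a * rieszSymbol 0 k + b * rieszSymbol 1 k) ^ 2 ∂F := by
    have e1 : ∀ k, (a * rieszSymbol 0 k + b * rieszSymbol 1 k) ^ 2
        = a ^ 2 * (rieszSymbol 0 k * rieszSymbol 0 k)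
          + 2 * a * b * (rieszSymbol 0 k * rieszSymbol 1 k)
          + b ^ 2 * (rieszSymbol 1 k * rieszSymbol 1 k) := fun k => by ring
    have h2 : Integrable (fun k => a ^ 2 * (rieszSymbol 0 k * rieszSymbol 0 k)
          + 2 * a * b * (rieszSymbol 0 k * rieszSymbol 1 k)) F :=
      ((hint 0 0).const_mul _).add ((hint 0 1).const_mul _)
    simp_rw [e1]
    rw [integral_add h2 ((hint 1 1).const_mul _), integral_add ((hint 0 0).const_mul _) ((hint 0 1).const_mul _),
      integral_const_mul, integral_const_mul, integral_const_mul, ← hr hg₀ hg₀, ← hr hg₀ hg₁,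
      ← hr hg₁ hg₁, norm_add_sq_real, norm_smul, norm_smul, real_inner_smul_left,
      real_inner_smul_right, real_inner_self_eq_norm_sq, real_inner_self_eq_norm_sq, mul_pow,
      mul_pow, Real.norm_eq_abs, Real.norm_eq_abs, sq_abs, sq_abs]
    ring
  rw [← norm_eq_zero, ← sq_eq_zero_iff, key, integral_eq_zero_iff_of_nonneg
    (fun k => sq_nonneg _)]
  · refine eventually_congr (.of_forall fun k => ?_)
    simp only [Pi.zero_apply, sq_eq_zero_iff, rieszSymbol]
    rcases eq_or_ne k 0 with rfl | hk
    · simp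
    · have h2 : ‖k‖ ≠ 0 := norm_ne_zero_iff.2 hk
      field_simp
      rw [mul_zero]
  · have e1 : ∀ k, (a * rieszSymbol 0 k + b * rieszSymbol 1 k) ^ 2
        = a ^ 2 * (rieszSymbol 0 k * rieszSymbol 0 k)
          + 2 * a * b * (rieszSymbol 0 k * rieszSymbol 1 k)
          + b ^ 2 * (rieszSymbol 1 k * rieszSymbol 1 k) := fun k => by ring
    simp_rw [e1]
    exact (((hint 0 0).const_mul _).add ((hint 0 1).const_mul _)).add ((hint 1 1).const_mul _)

theorem inner_direction_add_pi_div_two (ν : ℝ) (k : Plane) :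
    inner ℝ (direction (ν + Real.pi / 2)) k = -Real.sin ν * k 0 + Real.cos ν * k 1 := by
  rw [inner_direction, Real.cos_add_pi_div_two, Real.sin_add_pi_div_two]

/-- The spectral measure of a unidirectional field lives on a line. -/
theorem IsSpectralMeasure.isUnidirectionalField_iff (h : IsSpectralMeasure f F)
    (hstat : IsStationaryField f) (ν : ℝ) :
    IsUnidirectionalField f ν ↔ ∀ᵐ k ∂F, -Real.sin ν * k 0 + Real.cos ν * k 1 = 0 := by
  have := h.finite
  constructor
  · rintro ⟨c, hc⟩
    -- Along the direction orthogonal to `n` the covariance keeps its value at zero; hence the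
    -- nonnegative function `1 - cos` has integral zero.
    have h1 : ∀ t : ℝ, ∀ᵐ k ∂F, Real.cos (t * (-Real.sin ν * k 0 + Real.cos ν * k 1)) = 1 := by
      intro t
      have hcc : fieldCov f 0 (t • direction (ν + Real.pi / 2)) = fieldCov f 0 0 := by
        rw [hc, hc, real_inner_smul_right, inner_direction_direction, inner_zero_right]
        simp
      have hi : ∀ z : Plane, Integrable (fun k : Plane => cexp (inner ℝ k z * I)) F := fun z => by
        simpa using integrable_spectralIntegrand (F := F) z (u := fun _ => 1) measurable_const
          (B := 1) (by simp)
      have hre : ∀ z : Plane, fieldCov f 0 z = ∫ k, Real.cos (inner ℝ k z) ∂F := fun z => by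
        have h2 := congrArg Complex.re (h.charFun_eq z)
        rw [ofReal_re, charFun_apply] at h2
        rw [← h2]
        refine (integral_re (hi z)).symm.trans ?_
        congr 1 with k
        rw [RCLike.re_eq_complex_re, exp_ofReal_mul_I_re]
      have hcos : ∀ z : Plane, Integrable (fun k : Plane => Real.cos (inner ℝ k z)) F := fun z =>
        Integrable.of_bound (C := 1)
          (show Continuous fun k : Plane => Real.cos (inner ℝ k z) by fun_prop).aestronglyMeasurable
          (.of_forall fun k => Real.abs_cos_le_one _)
      rw [hre, hre] at hcc
      have h3 : ∫ k, (Real.cos (inner ℝ k (0 : Plane))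
          - Real.cos (inner ℝ k (t • direction (ν + Real.pi / 2)))) ∂F = 0 := by
        rw [integral_sub (hcos _) (hcos _), hcc, sub_self]
      have h4 : Integrable (fun k : Plane => Real.cos (inner ℝ k (0 : Plane))
          - Real.cos (inner ℝ k (t • direction (ν + Real.pi / 2)))) F := (hcos _).sub (hcos _)
      rw [integral_eq_zero_iff_of_nonneg (fun k => ?_) h4] at h3
      swap
      · simpa using Real.cos_le_one _
      filter_upwards [h3] with k hk
      rw [inner_zero_right, Real.cos_zero, real_inner_smul_right, real_inner_comm,
        inner_direction_add_pi_div_two] at hk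
      simp only [Pi.zero_apply] at hk
      linarith
    -- Countably many values of `t` share one null set. For large `n` the argument of the cosine is
    -- smaller than `1` in absolute value, so that cosine equal to one forces it to be zero.
    have h2 : ∀ᵐ k ∂F, ∀ n : ℕ,
        Real.cos (1 / ((n : ℝ) + 1) * (-Real.sin ν * k 0 + Real.cos ν * k 1)) = 1 :=
      ae_all_iff.2 fun n => h1 _
    filter_upwards [h2] with k hk
    set u := -Real.sin ν * k 0 + Real.cos ν * k 1
    obtain ⟨n, hn⟩ := exists_nat_gt |u|
    have hn1 : (0 : ℝ) < (n : ℝ) + 1 := by positivity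
    have hlt : |1 / ((n : ℝ) + 1) * u| < 1 := by
      rw [abs_mul, abs_of_pos (by positivity), one_div, inv_mul_lt_iff₀ hn1]
      linarith
    have hpi := Real.pi_gt_three
    have := (Real.cos_eq_one_iff_of_lt_of_lt (by linarith [(abs_lt.1 hlt).1])
      (by linarith [(abs_lt.1 hlt).2])).1 (hk n)
    have hne : 1 / ((n : ℝ) + 1) ≠ 0 := by positivity
    exact (mul_eq_zero.1 this).resolve_left hne
  · intro hk
    -- The profile `C` is the covariance along the line spanned by `n`. For `k` on that line, `⟨k,
    -- ξ⟩` sees only the projection of `ξ` onto `n`.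
    refine ⟨fun t => fieldCov f 0 (t • direction ν), fun x ξ => ?_⟩
    rw [hstat x 0]
    apply ofReal_injective
    rw [← h.charFun_eq, ← h.charFun_eq, charFun_apply, charFun_apply]
    refine integral_congr_ae ?_
    filter_upwards [hk] with k hk
    congr 3
    have hkn : inner ℝ k (direction ν) = Real.cos ν * k 0 + Real.sin ν * k 1 := by
      rw [real_inner_comm, inner_direction]
    rw [real_inner_smul_right, inner_direction, hkn, PiLp.inner_apply, Fin.sum_univ_two]
    simp only [RCLike.inner_apply, conj_trivial]
    have hcs := Real.sin_sq_add_cos_sq ν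
    linear_combination (Real.cos ν * ξ 1 - Real.sin ν * ξ 0) * hk
      - (k 0 * ξ 0 + k 1 * ξ 1) * hcs

/-- A field without constant component has no spectral mass at the origin. -/
theorem IsSpectralMeasure.singleton_zero (h : IsSpectralMeasure f F)
    (hconst : HasNoConstantComponent f) : F {0} = 0 := by
  have := h.finite
  set K : ℝ → Plane → ℝ := fun R => (Metric.ball (0 : Plane) R).indicator
    fun _ => (volume.real (Metric.ball (0 : Plane) R))⁻¹ with hK
  have hKi : ∀ R, Integrable (K R) := fun R => by
    rw [hK, integrable_indicator_iff Metric.isOpen_ball.measurableSet]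
    exact integrableOn_const (measure_ball_lt_top).ne
  have hav : ∀ R, ⨍ y in Metric.ball (0 : Plane) R, f y = movingAverage (K R) f 0 := fun R => by
    rw [setAverage_eq, movingAverage, ← integral_smul,
      ← integral_indicator Metric.isOpen_ball.measurableSet]
    congr 1
    funext y
    simp only [hK]
    by_cases hy : y ∈ Metric.ball (0 : Plane) R
    · rw [Set.indicator_of_mem hy, Set.indicator_of_mem hy, zero_add]
    · rw [Set.indicator_of_notMem hy, Set.indicator_of_notMem hy, zero_smul]
  have hone : ∀ R, 0 < R → kernelTransform (K R) 0 = 1 := fun R hR => by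
    have h1 : 0 < volume.real (Metric.ball (0 : Plane) R) :=
      ENNReal.toReal_pos (Metric.measure_ball_pos volume _ hR).ne' (measure_ball_lt_top).ne
    simp only [kernelTransform, inner_zero_left, ofReal_zero, zero_mul, Complex.exp_zero, mul_one]
    rw [integral_complex_ofReal, hK, integral_indicator Metric.isOpen_ball.measurableSet,
      setIntegral_const, smul_eq_mul, mul_inv_cancel₀ h1.ne', ofReal_one]
  -- The symbol of the disc average equals `1` at the origin, so the mass there is at most the
  -- integral of its squared modulus, which is the mean square of the average.
  have hle : ∀ R, 0 < R → F.real {0} ≤ ‖movingAverage (K R) f 0‖ ^ 2 := fun R hR => by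
    have hc := continuous_kernelTransform (hKi R)
    have hi : Integrable (fun k => ‖kernelTransform (K R) k‖ ^ 2) F := by
      refine Integrable.of_bound (C := (∫ y, ‖K R y‖) ^ 2)
        (hc.norm.pow 2).aestronglyMeasurable (.of_forall fun k => ?_)
      rw [norm_pow, norm_norm]
      exact pow_le_pow_left₀ (norm_nonneg _) (norm_kernelTransform_le k) 2
    have h1 : ‖movingAverage (K R) f 0‖ ^ 2 = ∫ k, ‖kernelTransform (K R) k‖ ^ 2 ∂F := by
      apply ofReal_injective
      rw [← real_inner_self_eq_norm_sq, inner_movingAverage_movingAverage h.continuous h.inner_eq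
        h.charFun_eq (hKi R) (hKi R), sub_self, spectralIntegral, ← integral_complex_ofReal]
      congr 1 with k
      rw [mul_conj, normSq_eq_norm_sq]
      simp
    rw [h1]
    calc F.real {0} = ∫ k in {(0 : Plane)}, ‖kernelTransform (K R) k‖ ^ 2 ∂F := by
          rw [integral_singleton, hone R hR]
          simp
      _ ≤ _ := setIntegral_le_integral hi (.of_forall fun k => by positivity)
  have hlim : Tendsto (fun R => ‖movingAverage (K R) f 0‖ ^ 2) atTop (𝓝 0) := by
    have := (hconst.congr hav).norm.pow 2
    simpa using this
  have h2 : F.real {0} ≤ 0 := by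
    refine ge_of_tendsto hlim ?_
    filter_upwards [eventually_gt_atTop 0] with R hR using hle R hR
  exact (measureReal_eq_zero_iff).1 (le_antisymm h2 measureReal_nonneg)

end RandomFieldSpectrum
end

/-! ### Quaternion algebra and propriety -/

noncomputable section

section Propriety

open scoped Quaternion

variable {Ω : Type*} [MeasurableSpace Ω] {P : Measure Ω}

@[simp] theorem quat_re (a b c d : ℝ) : (quat a b c d).re = a := rfl

@[simp] theorem quat_imI (a b c d : ℝ) : (quat a b c d).imI = b := rfl

@[simp] theorem quat_imJ (a b c d : ℝ) : (quat a b c d).imJ = c := rfl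

@[simp] theorem quat_imK (a b c d : ℝ) : (quat a b c d).imK = d := rfl

theorem mul_self_of_isPureUnit {η : Quaternion ℝ} (h : IsPureUnit η) : η * η = -1 := by
  have h1 : η * star η = 1 := by
    rw [Quaternion.self_mul_star, Quaternion.normSq_eq_norm_mul_self, h.2]
    simp
  rw [Quaternion.star_eq_neg.2 h.1, mul_neg] at h1
  rw [← h1, neg_neg]

theorem mul_eq_neg_mul_of_orthogonal {η η' : Quaternion ℝ} (h : η.re = 0) (h' : η'.re = 0)
    (ho : inner ℝ η η' = 0) : η' * η = -(η * η') := by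
  have h1 : η.imI * η'.imI + η.imJ * η'.imJ + η.imK * η'.imK = 0 := by
    rw [Quaternion.inner_def] at ho
    simpa [h, h'] using ho
  ext <;> simp [h, h'] <;> linarith

theorem isPureUnit_etaOf (ν : ℝ) : IsPureUnit (etaOf ν) := by
  refine ⟨rfl, ?_⟩
  rw [← sq_eq_sq₀ (norm_nonneg _) zero_le_one, sq, ← Quaternion.normSq_eq_norm_mul_self,
    Quaternion.normSq_def']
  simp [etaOf]

/-- Conjugation by a pure unit quaternion orthogonal to `η`, restricted to `ℂ^η`. -/
theorem star_involution_of_orthogonal {η η' : Quaternion ℝ} (h : IsPureUnit η)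
    (h' : IsPureUnit η') (ho : inner ℝ η η' = 0) (a b : ℝ) :
    star (involution η' (a • (1 : Quaternion ℝ) + b • η)) = a • (1 : Quaternion ℝ) + b • η := by
  have h1 : η' * (a • (1 : Quaternion ℝ) + b • η) * η' = -(a • (1 : Quaternion ℝ)) + b • η := by
    rw [mul_add, add_mul, mul_smul_comm, mul_smul_comm, smul_mul_assoc, smul_mul_assoc, mul_one,
      mul_self_of_isPureUnit h', mul_eq_neg_mul_of_orthogonal h.1 h'.1 ho, neg_mul, mul_assoc,
      mul_self_of_isPureUnit h']
    simp
  rw [involution, h1]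
  ext <;> simp [h.1]

theorem smul_one_add_smul_mul {η : Quaternion ℝ} (h : IsPureUnit η) (a b a' b' : ℝ) :
    (a • (1 : Quaternion ℝ) + b • η) * (a' • (1 : Quaternion ℝ) + b' • η)
      = (a * a' - b * b') • (1 : Quaternion ℝ) + (a * b' + b * a') • η := by
  simp only [mul_add, add_mul, smul_mul_smul_comm, mul_self_of_isPureUnit h, mul_one, one_mul]
  module

/-- For values in `ℂ^η` the second factor is `q'` itself, so the integral is that of a product of
complex numbers; `h1` and `h2` annihilate its real part and its `η` part. -/
theorem integral_propriety {η η' : Quaternion ℝ} (h : IsPureUnit η) (h' : IsPureUnit η')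
    (ho : inner ℝ η η' = 0) {a b a' b' : Lp ℝ 2 P} {q q' : Ω → Quaternion ℝ}
    (hq : ∀ᵐ ω ∂P, q ω = a ω • (1 : Quaternion ℝ) + b ω • η)
    (hq' : ∀ᵐ ω ∂P, q' ω = a' ω • (1 : Quaternion ℝ) + b' ω • η)
    (h1 : inner ℝ a a' = inner ℝ b b') (h2 : inner ℝ a b' + inner ℝ b a' = (0 : ℝ)) :
    ∫ ω, q ω * star (involution η' (q' ω)) ∂P = 0 := by
  have e : (fun ω => q ω * star (involution η' (q' ω))) =ᵐ[P] fun ω =>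
      (a ω * a' ω - b ω * b' ω) • (1 : Quaternion ℝ) + (a ω * b' ω + b ω * a' ω) • η := by
    filter_upwards [hq, hq'] with ω hω hω'
    rw [hω, hω', star_involution_of_orthogonal h h' ho, smul_one_add_smul_mul h]
  have i1 : Integrable (fun ω => a ω * a' ω - b ω * b' ω) P :=
    (integrable_mul_Lp a a').sub (integrable_mul_Lp b b')
  have i2 : Integrable (fun ω => a ω * b' ω + b ω * a' ω) P :=
    (integrable_mul_Lp a b').add (integrable_mul_Lp b a')
  rw [integral_congr_ae e, integral_add (i1.smul_const _) (i2.smul_const _), integral_smul_const,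
    integral_smul_const, integral_sub (integrable_mul_Lp a a') (integrable_mul_Lp b b'),
    integral_add (integrable_mul_Lp a b') (integrable_mul_Lp b a'), integral_mul_Lp,
    integral_mul_Lp, integral_mul_Lp, integral_mul_Lp, h1, h2]
  simp

theorem norm_quat_sq (a b c d : ℝ) : ‖quat a b c d‖ ^ 2 = a ^ 2 + b ^ 2 + c ^ 2 + d ^ 2 := by
  rw [sq, ← Quaternion.normSq_eq_norm_mul_self, Quaternion.normSq_def']
  rfl

theorem quat_eq_smul (a b c : ℝ) :
    quat a b c 0 = a • (1 : Quaternion ℝ) + b • quat 0 1 0 0 + c • quat 0 0 1 0 := by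
  ext <;> simp

/-- `-sin(ν) i + cos(ν) j` is a pure unit quaternion. -/
theorem isPureUnit_etaPerp (ν : ℝ) : IsPureUnit (quat 0 (-Real.sin ν) (Real.cos ν) 0) := by
  refine ⟨rfl, ?_⟩
  rw [← sq_eq_sq₀ (norm_nonneg _) zero_le_one, norm_quat_sq]
  simp

/-- On vector parts, `q ↦ (q^(η'))*` is the reflection reversing `η'`. The last bracket is therefore
the squared `η'`-component `(-sin ν b + cos ν c)²`, expanded so that it can be integrated term by
term. -/
theorem re_mul_star_involution_etaPerp (ν a b c : ℝ) :
    (quat a b c 0 * star (involution (quat 0 (-Real.sin ν) (Real.cos ν) 0) (quat a b c 0))).re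
      = a * a - b * b - c * c + 2 * (Real.sin ν ^ 2 * (b * b)
        - 2 * Real.sin ν * Real.cos ν * (b * c) + Real.cos ν ^ 2 * (c * c)) := by
  have h := Real.sin_sq_add_cos_sq ν
  simp [involution]
  linear_combination (a ^ 2 - b ^ 2 - c ^ 2) * h

/-- The real part of the complementary variance with respect to `-sin(ν) i + cos(ν) j`. -/
theorem re_integral_etaPerp (ν : ℝ) {a b c : Lp ℝ 2 P} {q : Ω → Quaternion ℝ}
    (hq : ∀ᵐ ω ∂P, q ω = quat (a ω) (b ω) (c ω) 0) :
    (∫ ω, q ω * star (involution (quat 0 (-Real.sin ν) (Real.cos ν) 0) (q ω)) ∂P).re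
      = ‖a‖ ^ 2 - ‖b‖ ^ 2 - ‖c‖ ^ 2 + 2 * ‖(-Real.sin ν) • b + Real.cos ν • c‖ ^ 2 := by
  set e : Quaternion ℝ := quat 0 (-Real.sin ν) (Real.cos ν) 0 with he
  have hm : AEStronglyMeasurable q P := by
    have : AEStronglyMeasurable (fun ω => quat (a ω) (b ω) (c ω) 0) P := by
      have e : (fun ω => quat (a ω) (b ω) (c ω) 0) = fun ω =>
          a ω • (1 : Quaternion ℝ) + b ω • quat 0 1 0 0 + c ω • quat 0 0 1 0 :=
        funext fun ω => quat_eq_smul _ _ _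
      rw [e]
      exact (((Lp.aestronglyMeasurable a).smul_const _).add
        ((Lp.aestronglyMeasurable b).smul_const _)).add ((Lp.aestronglyMeasurable c).smul_const _)
    exact this.congr (hq.mono fun ω h => h.symm)
  have hen : ‖e‖ = 1 := (isPureUnit_etaPerp ν).2
  have hint : Integrable (fun ω => q ω * star (involution e (q ω))) P := by
    have hc : Continuous fun p : Quaternion ℝ => p * star (involution e p) := by
      unfold involution
      fun_prop
    refine Integrable.mono' (((integrable_mul_Lp a a).add (integrable_mul_Lp b b)).add
      (integrable_mul_Lp c c)) (hc.comp_aestronglyMeasurable hm) ?_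
    filter_upwards [hq] with ω hω
    rw [norm_mul, norm_star, involution, norm_neg, norm_mul, norm_mul, hen, one_mul, mul_one, ← sq,
      hω, norm_quat_sq]
    refine le_of_eq ?_
    simp only [Pi.add_apply]
    ring
  -- As an inner product with `1`, the real part commutes with the Bochner integral.
  have hre : ∀ p : Quaternion ℝ, p.re = inner ℝ 1 p := fun p => by
    rw [Quaternion.inner_def]
    simp
  have h1 : ∫ ω, (q ω * star (involution e (q ω))).re ∂P
      = ∫ ω, (a ω * a ω - b ω * b ω - c ω * c ω + 2 * (Real.sin ν ^ 2 * (b ω * b ω)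
        - 2 * Real.sin ν * Real.cos ν * (b ω * c ω) + Real.cos ν ^ 2 * (c ω * c ω))) ∂P := by
    refine integral_congr_ae ?_
    filter_upwards [hq] with ω hω
    rw [hω, he, re_mul_star_involution_etaPerp]
  have ia := integrable_mul_Lp a a
  have ib := integrable_mul_Lp b b
  have ic := integrable_mul_Lp c c
  have ibc := integrable_mul_Lp b c
  have i1 : Integrable (fun ω => a ω * a ω - b ω * b ω) P := ia.sub ib
  have i2 : Integrable (fun ω => a ω * a ω - b ω * b ω - c ω * c ω) P := i1.sub ic
  have i3 : Integrable (fun ω => Real.sin ν ^ 2 * (b ω * b ω)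
      - 2 * Real.sin ν * Real.cos ν * (b ω * c ω)) P := (ib.const_mul _).sub (ibc.const_mul _)
  have i4 : Integrable (fun ω => Real.sin ν ^ 2 * (b ω * b ω)
      - 2 * Real.sin ν * Real.cos ν * (b ω * c ω) + Real.cos ν ^ 2 * (c ω * c ω)) P :=
    i3.add (ic.const_mul _)
  rw [hre, ← integral_inner hint]
  simp_rw [← hre]
  rw [h1, integral_add i2 (i4.const_mul _), integral_sub i1 ic, integral_sub ia ib,
    integral_const_mul, integral_add i3 (ic.const_mul _),
    integral_sub (ib.const_mul _) (ibc.const_mul _), integral_const_mul, integral_const_mul,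
    integral_const_mul, integral_mul_Lp, integral_mul_Lp, integral_mul_Lp, integral_mul_Lp,
    norm_add_sq_real, norm_smul, norm_smul, real_inner_smul_left, real_inner_smul_right,
    real_inner_self_eq_norm_sq, real_inner_self_eq_norm_sq, real_inner_self_eq_norm_sq, mul_pow,
    mul_pow, Real.norm_eq_abs, Real.norm_eq_abs, sq_abs, sq_abs]
  ring

variable {f : RandomField P} {F : Measure Plane}

/-- The Riesz component orthogonal to `n` vanishes, so the vector `(g₀, g₁)` equals `G n` and `m = f
+ G η` is `ℂ^η`-valued. The covariance identities then say that `f` and `G` have equal covariances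
and antisymmetric cross-covariance. -/
theorem IsSpectralMeasure.isProperField_of_ae (h : IsSpectralMeasure f F) (h0 : F {0} = 0)
    {g₀ g₁ : RandomField P} (hg₀ : IsRieszTransform 0 f g₀) (hg₁ : IsRieszTransform 1 f g₁)
    {m : Plane → Ω → Quaternion ℝ} (hm : ∀ x, ∀ᵐ ω ∂P, m x ω = quat (f x ω) (g₀ x ω) (g₁ x ω) 0)
    {ν : ℝ} (hν : ∀ᵐ k ∂F, -Real.sin ν * k 0 + Real.cos ν * k 1 = 0) :
    IsProperField P (etaOf ν) m := by
  have hcs := Real.sin_sq_add_cos_sq ν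
  set G : RandomField P := fun x => Real.cos ν • g₀ x + Real.sin ν • g₁ x with hG
  have hperp : ∀ x, (-Real.sin ν) • g₀ x + Real.cos ν • g₁ x = 0 := fun x =>
    (h.smul_riesz_add_smul_riesz_eq_zero_iff hg₀ hg₁ _ _ x).2 hν
  have e₀ : ∀ x, g₀ x = Real.cos ν • G x := fun x => by
    have h1 : g₀ x - Real.cos ν • G x = (-Real.sin ν) • ((-Real.sin ν) • g₀ x + Real.cos ν • g₁ x) := by
      have h2 : g₀ x = (Real.sin ν ^ 2 + Real.cos ν ^ 2) • g₀ x := by rw [hcs, one_smul]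
      rw [hG]
      nth_rewrite 1 [h2]
      module
    rw [hperp, smul_zero] at h1
    exact sub_eq_zero.1 h1
  have e₁ : ∀ x, g₁ x = Real.sin ν • G x := fun x => by
    have h1 : g₁ x - Real.sin ν • G x = (Real.cos ν) • ((-Real.sin ν) • g₀ x + Real.cos ν • g₁ x) := by
      have h2 : g₁ x = (Real.sin ν ^ 2 + Real.cos ν ^ 2) • g₁ x := by rw [hcs, one_smul]
      rw [hG]
      nth_rewrite 1 [h2]
      module
    rw [hperp, smul_zero] at h1
    exact sub_eq_zero.1 h1
  have hmG : ∀ x, ∀ᵐ ω ∂P, m x ω = f x ω • (1 : Quaternion ℝ) + G x ω • etaOf ν := fun x => by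
    filter_upwards [hm x, Lp.coeFn_smul (Real.cos ν) (G x), Lp.coeFn_smul (Real.sin ν) (G x)]
      with ω h1 h2 h3
    rw [h1, e₀ x, e₁ x, h2, h3]
    ext <;> simp [etaOf, mul_comm]
  have c1 : ∀ x y, inner ℝ (f x) (f y) = inner ℝ (G x) (G y) := fun x y => by
    rw [← h.inner_riesz_add_inner_riesz h0 hg₀ hg₁, e₀ x, e₀ y, e₁ x, e₁ y]
    simp only [real_inner_smul_left, real_inner_smul_right]
    linear_combination inner ℝ (G x) (G y) * hcs
  have c2 : ∀ x y, inner ℝ (f x) (G y) + inner ℝ (G x) (f y) = (0 : ℝ) := fun x y => by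
    have h1 := h.inner_field_riesz_add hg₀ x y
    have h2 := h.inner_field_riesz_add hg₁ x y
    simp only [hG, inner_add_left, inner_add_right, real_inner_smul_left, real_inner_smul_right]
    linear_combination Real.cos ν * h1 + Real.sin ν * h2
  intro N x η' η'' h' h'' ho' ho'' _
  constructor
  · refine Matrix.ext fun a b => ?_
    exact integral_propriety (isPureUnit_etaOf ν) h' ho' (hmG _) (hmG _) (c1 _ _) (c2 _ _)
  · refine Matrix.ext fun a b => ?_
    exact integral_propriety (isPureUnit_etaOf ν) h'' ho'' (hmG _) (hmG _) (c1 _ _) (c2 _ _)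

/-- The variance at a single point and a single `η'` suffice: `‖f‖²` cancels against `‖g₀‖² +
‖g₁‖²`, leaving twice the squared norm of the component orthogonal to `n`. -/
theorem IsSpectralMeasure.ae_of_isProperField (h : IsSpectralMeasure f F) (h0 : F {0} = 0)
    {g₀ g₁ : RandomField P} (hg₀ : IsRieszTransform 0 f g₀) (hg₁ : IsRieszTransform 1 f g₁)
    {m : Plane → Ω → Quaternion ℝ} (hm : ∀ x, ∀ᵐ ω ∂P, m x ω = quat (f x ω) (g₀ x ω) (g₁ x ω) 0)
    {ν : ℝ} (hp : IsProperField P (etaOf ν) m) :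
    ∀ᵐ k ∂F, -Real.sin ν * k 0 + Real.cos ν * k 1 = 0 := by
  have hk : IsPureUnit (quat 0 0 0 1) := by
    refine ⟨rfl, ?_⟩
    rw [← sq_eq_sq₀ (norm_nonneg _) zero_le_one, norm_quat_sq]
    simp
  have h1 := (hp 1 (fun _ => 0) (quat 0 (-Real.sin ν) (Real.cos ν) 0) (quat 0 0 0 1)
    (isPureUnit_etaPerp ν) hk (by rw [Quaternion.inner_def]; simp [etaOf]; ring)
    (by rw [Quaternion.inner_def]; simp [etaOf])
    (by rw [Quaternion.inner_def]; simp)).1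
  have h2 : ∫ ω, m 0 ω * star (involution (quat 0 (-Real.sin ν) (Real.cos ν) 0) (m 0 ω)) ∂P = 0 :=
    congrFun (congrFun h1 0) 0
  have h3 := re_integral_etaPerp ν (hm 0)
  have h4 := h.inner_riesz_add_inner_riesz h0 hg₀ hg₁ 0 0
  simp only [real_inner_self_eq_norm_sq] at h4
  rw [h2, Quaternion.re_zero] at h3
  refine (h.smul_riesz_add_smul_riesz_eq_zero_iff hg₀ hg₁ _ _ 0).1 ?_
  rw [← norm_eq_zero, ← sq_eq_zero_iff]
  linarith

end Propriety
end

/-! ### The equivalence, through the support of the spectral measure -/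

theorem theorem1 {Ω : Type*} [MeasurableSpace Ω] (P : Measure Ω) [IsProbabilityMeasure P]
    (f : RandomField P) (hmean : IsZeroMean f) (hcont : Continuous f)
    (hstat : IsStationaryField f) (hconst : HasNoConstantComponent f) (ν : ℝ) :
    (∃ m : Plane → Ω → Quaternion ℝ, IsMonogenicSignal f m) ∧
      ∀ m : Plane → Ω → Quaternion ℝ, IsMonogenicSignal f m →
        (IsProperField P (etaOf ν) m ↔ IsStationaryField f ∧ IsUnidirectionalField f ν) := by
  obtain ⟨F, hF⟩ := exists_isSpectralMeasure hcont hstat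
  have h0 := hF.singleton_zero hconst
  constructor
  · obtain ⟨g₀, hg₀⟩ := hF.exists_isRieszTransform 0
    obtain ⟨g₁, hg₁⟩ := hF.exists_isRieszTransform 1
    exact ⟨fun x ω => quat (f x ω) (g₀ x ω) (g₁ x ω) 0, g₀, g₁, hg₀, hg₁,
      fun x => .of_forall fun ω => rfl⟩
  · rintro m ⟨g₀, g₁, hg₀, hg₁, hm⟩
    rw [hF.isUnidirectionalField_iff hstat ν]
    exact ⟨fun hp => ⟨hstat, hF.ae_of_isProperField h0 hg₀ hg₁ hm hp⟩,
      fun hν => hF.isProperField_of_ae h0 hg₀ hg₁ hm hν.2⟩
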